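/- **Definitions.** Let $\mathfrak N$ be a separable complex Hilbert space. An *operator measure* $dF$ on $\mathbb R$ with values in $\mathfrak N$ is $dF(x)=A(x)\,d\mu(x)$, where $\mu$ is a finite Borel measure on $\mathbb R$ with $\mu(\{0\})=0$ and $A(x)\ge 0$ are bounded operators in $\mathfrak N$ such that $x\mapsto A(x)v$ is strongly measurable and $\langle A(\cdot)w,v\rangle$ is $\mu$-integrable for all $v,w\in\mathfrak N$; its distribution function, $F(t)=\int_{(0,t]}A\,d\mu$ for $t\ge0$ and $F(t)=-\int_{[t,0)}A\,d\mu$ for $t<0$ (weak integrals), is assumed to take values in the bounded operators; it is non-decreasing. The Hilbert space $L^2_{\mathbb R}(\mathfrak N,dF)$ is the completion, after factorization by functions of norm $0$, of the space of strongly measurable $f:\mathbb R\to\mathfrak N$ with $\|f\|^2=\int\langle dF(x)f(x),f(x)\rangle:=\int\langle A(x)f(x),f(x)\rangle\,d\mu(x)<\infty$. It is denoted by $L^2_{\mathbb R_+}(\mathfrak N,dF)$ if $\mu((-\infty,0])=0$. A bounded operator on it is said to act by a formula if it does so on every such function $f$. For an operator-valued function $n(x)$, $dF\,n=n\,dF$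 means $A(x)n(x)=n(x)A(x)$ for $\mu$-almost all $x$. **Theorem.** Let $B$ and $D$ be bounded self-adjoint operators in a separable complex Hilbert space $H$ with $DB+BD=0$ and $\operatorname{Ker}DB=\{0\}$. Then there are a separable complex Hilbert space $\mathfrak N$; an operator measure $dF$ with $\mu((-\infty,0])=0$, $F(t)=I_{\mathfrak N}$ for all $t\ge\|B\|$, and $\langle F(t)e_j,e_i\rangle=0$ for all $t$ and all $i\ne j$, for some orthonormal basis $(e_i)$ of $\mathfrak N$; an operator measure $dF_s$ whose distribution function is the odd extension of $F$, i.e. $F_s(-t)=-F_s(t)$ for all $t$ and $F_s(t)=F(t)$ for $t\ge0$; and an operator-valued function $n$ on $\mathbb R$, with values in the bounded operators in $\mathfrak N$ and with $x\mapsto n(x)v$ strongly measurable for all $v\in\mathfrak N$, such that $n(x)\ge0$ and $n(-x)=n(x)$ for all $x$, $dF\,n=n\,dF$, $dF_s\,n=n\,dF_s$, and the following hold. 1. There is a unitary operator $U:H\to L^2_{\mathbb R_+}(\mathfrak N,dF)\otimes\mathbb C^2$ (columns $f=\operatorname{col}[f_1,f_2]$) such that $UBU^{-1}=\widetilde B$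 and $UDU^{-1}=\widetilde D$ are the bounded operators $$(\widetilde Bf)(x)=\begin{bmatrix}I_{\mathfrak N}&0\\0&-I_{\mathfrak N}\end{bmatrix}x f(x),\qquad(\widetilde Df)(x)=\begin{bmatrix}0&n(x)\\n(x)&0\end{bmatrix}f(x).$$ 2. There is a unitary operator $U_s:H\to L^2_{\mathbb R}(\mathfrak N,dF_s)$ such that $U_sBU_s^{-1}$ and $U_sDU_s^{-1}$ are the bounded operators $f\mapsto x f(x)$ and $f\mapsto n(x)f(-x)$. 3. The two realizations correspond to each other: if $f_1,f_2$ are functions with $\int\langle dF f_k,f_k\rangle<\infty$, then $\widetilde f(x)=f_1(x)$ for $x>0$, $\widetilde f(x)=f_2(-x)$ for $x\le0$, satisfies $\int\langle dF_s\widetilde f,\widetilde f\rangle<\infty$ and $U_s^{-1}\widetilde f=U^{-1}\operatorname{col}[f_1,f_2]$. -/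

import Mathlib

open MeasureTheory
open scoped InnerProductSpace

noncomputable section

/-- An operator measure `dF = A dμ` on the real line, with values in the bounded operators of the
Hilbert space `N`, without atom at `0`. It is given by its distribution function `dist`, normalised
by `dist 0 = 0`: for `t ≥ 0` the operator `dist t` is `dF((0,t])`, and for `t < 0` it is
`-dF([t,0))`. So `dist` is a non-decreasing operator-valued function. The finite scalar measure
`base` is `μ`, the density `density` is `A`, with values in the non-negative bounded operators;
these give `⟨dF f, g⟩` its meaning `⟨A f, g⟩ dμ`. -/
structure OperatorMeasure (N : Type*) [NormedAddCommGroup N] [InnerProductSpace ℂ N] where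
  dist : ℝ → N →L[ℂ] N
  base : Measure ℝ
  density : ℝ → N →L[ℂ] N
  base_finite : IsFiniteMeasure base
  base_zero : base {0} = 0
  density_nonneg : ∀ x, (density x).IsPositive
  density_measurable : ∀ v, StronglyMeasurable fun x => density x v
  density_integrable : ∀ v w, Integrable (fun x => ⟪v, density x w⟫_ℂ) base
  dist_of_nonneg : ∀ t, 0 ≤ t → ∀ v w,
    ⟪v, dist t w⟫_ℂ = ∫ x in Set.Ioc 0 t, ⟪v, density x w⟫_ℂ ∂base
  dist_of_neg : ∀ t, t < 0 → ∀ v w,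
    ⟪v, dist t w⟫_ℂ = -∫ x in Set.Ico t 0, ⟪v, density x w⟫_ℂ ∂base

namespace OperatorMeasure

variable {N : Type*} [NormedAddCommGroup N] [InnerProductSpace ℂ N]

/-- `f` is a (strongly measurable) `N`-valued function with `∫ ⟨dF(x) f(x), f(x)⟩ < ∞`. -/
def SqIntegrable (F : OperatorMeasure N) (f : ℝ → N) : Prop :=
  AEStronglyMeasurable f F.base ∧
    Integrable (fun x => ⟪f x, F.density x (f x)⟫_ℂ) F.base

theorem aestronglyMeasurable_density (F : OperatorMeasure N) {f : ℝ → N}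
    (hf : AEStronglyMeasurable f F.base) :
    AEStronglyMeasurable (fun x => F.density x (f x)) F.base := by
  obtain ⟨g, hg, hfg⟩ := hf
  refine ⟨fun x => F.density x (g x), ?_, ?_⟩
  · refine stronglyMeasurable_of_tendsto Filter.atTop
      (f := fun n x => F.density x (hg.approx n x)) (fun n => ?_) ?_
    · have : (fun x => F.density x (hg.approx n x)) = fun x =>
          ∑ v ∈ (hg.approx n).range, ((hg.approx n) ⁻¹' {v}).indicator
            (fun x => F.density x v) x := by
        funext x
        rw [Finset.sum_eq_single (hg.approx n x)]
        · simp
        · intro v _ hv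
          simp [Set.indicator, Ne.symm hv]
        · intro h
          exact absurd (SimpleFunc.mem_range_self _ x) h
      rw [this]
      exact Finset.stronglyMeasurable_fun_sum _ fun v _ =>
        (F.density_measurable v).indicator ((hg.approx n).measurableSet_fiber v)
    · rw [tendsto_pi_nhds]
      exact fun x => ((F.density x).continuous.tendsto _).comp (hg.tendsto_approx x)
  · filter_upwards [hfg] with x hx
    rw [hx]

theorem SqIntegrable.add {F : OperatorMeasure N} {f g : ℝ → N}
    (hf : F.SqIntegrable f) (hg : F.SqIntegrable g) : F.SqIntegrable (f + g) := by
  have hm := hf.1.add hg.1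
  refine ⟨hm, ((hf.2.norm.const_mul 2).add (hg.2.norm.const_mul 2)).mono'
    (hm.inner (F.aestronglyMeasurable_density hm)) (Filter.Eventually.of_forall fun x => ?_)⟩
  have pos := fun v => (F.density_nonneg x).re_inner_nonneg_right v
  have nrm : ∀ v, ‖⟪v, F.density x v⟫_ℂ‖ = (⟪v, F.density x v⟫_ℂ).re := fun v => by
    exact (Complex.re_eq_norm.2 ((F.density_nonneg x).inner_nonneg_right v)).symm
  have h1 := pos (f x - g x)
  simp only [Pi.add_apply, nrm]
  simp only [map_add, map_sub, inner_add_left, inner_add_right, inner_sub_left, inner_sub_right,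
    RCLike.re_to_complex, Complex.add_re] at h1 ⊢
  linarith

theorem SqIntegrable.smul {F : OperatorMeasure N} {f : ℝ → N} (c : ℂ)
    (hf : F.SqIntegrable f) : F.SqIntegrable (c • f) := by
  refine ⟨hf.1.const_smul c, ?_⟩
  have : (fun x => ⟪(c • f) x, F.density x ((c • f) x)⟫_ℂ) =
      fun x => (starRingEnd ℂ c * c) * ⟪f x, F.density x (f x)⟫_ℂ := by
    funext x
    simp only [Pi.smul_apply, map_smul, inner_smul_left, inner_smul_right]
    ring
  rw [this]
  exact hf.2.const_mul _

/-- The functions `f` with `∫ ⟨dF(x) f(x), f(x)⟩ < ∞`, as a linear subspace. -/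
def sqIntegrable (F : OperatorMeasure N) : Submodule ℂ (ℝ → N) where
  carrier := {f | F.SqIntegrable f}
  add_mem' := SqIntegrable.add
  zero_mem' := ⟨aestronglyMeasurable_const, by simp⟩
  smul_mem' c _ hf := hf.smul c

/-- The same space of functions, as a type without the topology of pointwise convergence. -/
def PreL2 (F : OperatorMeasure N) : Type _ := F.sqIntegrable

instance (F : OperatorMeasure N) : AddCommGroup F.PreL2 :=
  inferInstanceAs (AddCommGroup F.sqIntegrable)

instance (F : OperatorMeasure N) : Module ℂ F.PreL2 :=
  inferInstanceAs (Module ℂ F.sqIntegrable)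

theorem integrable_inner {F : OperatorMeasure N} {f g : ℝ → N}
    (hf : F.SqIntegrable f) (hg : F.SqIntegrable g) :
    Integrable (fun x => ⟪f x, F.density x (g x)⟫_ℂ) F.base := by
  refine (hf.2.norm.add hg.2.norm).mono'
    (hf.1.inner (F.aestronglyMeasurable_density hg.1)) (Filter.Eventually.of_forall fun x => ?_)
  let c : PreInnerProductSpace.Core ℂ N :=
    { inner := fun v w => ⟪v, F.density x w⟫_ℂ
      conj_inner_symm := fun v w => by
        rw [inner_conj_symm]
        exact (F.density_nonneg x).inner_left_eq_inner_right v w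
      re_inner_nonneg := fun v => (F.density_nonneg x).re_inner_nonneg_right v
      add_left := fun u v w => inner_add_left _ _ _
      smul_left := fun u v r => inner_smul_left _ _ _ }
  have cs := @InnerProductSpace.Core.inner_mul_inner_self_le ℂ N _ _ _ c (f x) (g x)
  have sy : ‖⟪g x, F.density x (f x)⟫_ℂ‖ = ‖⟪f x, F.density x (g x)⟫_ℂ‖ := by
    rw [← (F.density_nonneg x).inner_left_eq_inner_right, ← inner_conj_symm, RCLike.norm_conj]
  change ‖⟪f x, F.density x (g x)⟫_ℂ‖ * ‖⟪g x, F.density x (f x)⟫_ℂ‖ ≤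
    (⟪f x, F.density x (f x)⟫_ℂ).re * (⟪g x, F.density x (g x)⟫_ℂ).re at cs
  rw [sy] at cs
  have h1 := Complex.re_le_norm ⟪f x, F.density x (f x)⟫_ℂ
  have h2 := Complex.re_le_norm ⟪g x, F.density x (g x)⟫_ℂ
  have p1 : 0 ≤ (⟪f x, F.density x (f x)⟫_ℂ).re :=
    (F.density_nonneg x).re_inner_nonneg_right (f x)
  have p2 : 0 ≤ (⟪g x, F.density x (g x)⟫_ℂ).re :=
    (F.density_nonneg x).re_inner_nonneg_right (g x)
  have p3 := norm_nonneg ⟪f x, F.density x (g x)⟫_ℂ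
  simp only [Pi.add_apply]
  nlinarith [sq_nonneg ((⟪f x, F.density x (f x)⟫_ℂ).re - (⟪g x, F.density x (g x)⟫_ℂ).re)]

/-- The (possibly degenerate) inner product `∫ ⟨dF(x) g(x), f(x)⟩ = ∫ ⟨A g, f⟩ dμ`; in Mathlib's
convention it is conjugate linear in the first argument `f`. -/
@[reducible] def preCore (F : OperatorMeasure N) : PreInnerProductSpace.Core ℂ F.PreL2 where
  inner f g := ∫ x, ⟪f.1 x, F.density x (g.1 x)⟫_ℂ ∂F.base
  conj_inner_symm f g := by
    rw [← integral_conj]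
    refine integral_congr_ae (Filter.Eventually.of_forall fun x => ?_)
    simp only
    rw [inner_conj_symm]
    exact (F.density_nonneg x).inner_left_eq_inner_right _ _
  re_inner_nonneg f := by
    have := integral_re (𝕜 := ℂ) (f := fun x => ⟪f.1 x, F.density x (f.1 x)⟫_ℂ) f.2.2
    rw [← this]
    exact integral_nonneg fun x => (F.density_nonneg x).re_inner_nonneg_right _
  add_left f g h := by
    rw [← integral_add (integrable_inner f.2 h.2) (integrable_inner g.2 h.2)]
    refine integral_congr_ae (Filter.Eventually.of_forall fun x => ?_)
    exact inner_add_left _ _ _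
  smul_left f g c := by
    rw [← integral_const_mul]
    refine integral_congr_ae (Filter.Eventually.of_forall fun x => ?_)
    exact inner_smul_left _ _ _

instance (F : OperatorMeasure N) : SeminormedAddCommGroup F.PreL2 :=
  @InnerProductSpace.Core.toSeminormedAddCommGroup ℂ F.PreL2 _ _ _ F.preCore

instance (F : OperatorMeasure N) : InnerProductSpace ℂ F.PreL2 :=
  InnerProductSpace.ofCore F.preCore

/-- The Hilbert space `L²(N, dF)`: the functions with `∫ ⟨dF(x) f(x), f(x)⟩ < ∞`, completed, and
with the functions of norm `0` identified with `0` (the completion does this). -/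
abbrev L2 (F : OperatorMeasure N) : Type _ := UniformSpace.Completion F.PreL2

/-- The element of `L²(N, dF)` given by the function `f`. -/
def toL2 (F : OperatorMeasure N) (f : ℝ → N) (hf : F.SqIntegrable f) : F.L2 :=
  UniformSpace.Completion.coe' (α := F.PreL2) ⟨f, hf⟩

/-- The bounded operator `T` on `L²(N, dF)` is given on functions by `f ↦ Φ f`. Since the functions
are dense in `L²(N, dF)`, at most one bounded operator has this property. -/
def ActsAs (F : OperatorMeasure N) (T : F.L2 →L[ℂ] F.L2) (Φ : (ℝ → N) → ℝ → N) : Prop :=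
  ∀ (f : ℝ → N) (hf : F.SqIntegrable f),
    ∃ hΦ : F.SqIntegrable (Φ f), T (F.toL2 f hf) = F.toL2 (Φ f) hΦ

end OperatorMeasure

end

/-! Since `Ker DB = {0}` and `DB = -BD`, both operators are injective. In the polar decompositions
`B = S|B|`, `D = J|D|` the factors `S`, `J` are self-adjoint unitaries. The moduli depend only on
`B²` and `D²`, so anticommutation passes to the signs: `SJ = -JS`, and each modulus commutes with
everything belonging to the other operator. Hence `J` exchanges the eigenspaces `S = 1` and `S =
-1`. With `K = ker(S - 1)`, `C = |B|` and `P = |D|` restricted to `K`, one gets `H = K ⊕ JK`, `B = C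
⊕ (-C)`, `D = [[0, P], [P, 0]]`, where `C` is positive and injective, `P ≥ 0` and `CP = PC`
(`exists_anticommuting_splitting`).

It remains to make `C` the multiplication by `x` and `P` the multiplication by an operator function
`n(x)` in one space `L²(N, dF)` (`exists_model`). Cyclic subspaces give `K = ⊕ L²(μ n)`
(`exists_spectral_representation`). Let `ν` be a finite measure dominating all `μ n`, with densities
`ρ n`. Using `diag(ρ n(x))` as density of `dF` would fail: an operator function commuting with
multiplications need not commute with this diagonal matrix. Instead the line is sorted by the
multiplicity `m(x)`, the number of `n` with `ρ n(x) > 0`. The basis of `N` is indexed by pairs `(k,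
r)` with `r < k` and `ν(m = k) ≠ 0`, and the density at `x` is `1 / ν(m = k)` times the projection
onto the vectors with `k = m(x)`. Each diagonal entry is then a probability measure, so `F(t) = I`
for large `t`; and the density is a scalar times a projection, so it commutes with every operator
that lives on the fibre. Sending the `n`-th index to its rank among those with positive density
identifies `⊕ L²(μ n)` with `L²(N, dF)` (`exists_isHilbertSum_vectorField`).

Applying the square root of the density embeds `L²(N, dF)` in `L²(ν; N)`. There the compression of
`P` commutes with continuous multiplications, so it is given by a measurable field of non-negative
operators (`exists_decomposition`). Finally, a pair of functions on the half-line is one function on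
the line, which gives the realization with the odd extension of `F` (`exists_reflect_equiv`). -/

noncomputable section

/-! ### Polar decomposition of an injective self-adjoint operator. -/

section Sign

variable {H : Type*} [NormedAddCommGroup H] [InnerProductSpace ℂ H] [CompleteSpace H]

theorem denseRange_of_selfAdjoint_of_injective {A : H →L[ℂ] H} (hA : IsSelfAdjoint A)
    (h0 : ∀ h, A h = 0 → h = 0) : DenseRange A := by
  have h1 : (LinearMap.range (A : H →ₗ[ℂ] H)).topologicalClosure = ⊤ := by
    rw [Submodule.topologicalClosure_eq_top_iff, Submodule.eq_bot_iff]
    intro x hx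
    apply h0
    have h2 : ⟪A (A x), x⟫_ℂ = 0 := (Submodule.mem_orthogonal _ _).1 hx _ ⟨A x, rfl⟩
    have h3 := (ContinuousLinearMap.isSelfAdjoint_iff_isSymmetric.1 hA) (A x) x
    simp only [ContinuousLinearMap.coe_coe] at h3
    rw [h2] at h3
    exact inner_self_eq_zero.1 h3.symm
  intro y
  have : y ∈ (LinearMap.range (A : H →ₗ[ℂ] H)).topologicalClosure := by rw [h1]; trivial
  exact this

omit [CompleteSpace H] in
theorem ContinuousLinearMap.eq_of_mul_denseRange {A X Y : H →L[ℂ] H} (hA : DenseRange A)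
    (h : X * A = Y * A) : X = Y := by
  have : (X : H → H) = Y := hA.equalizer X.continuous Y.continuous (by
    funext x
    exact congrArg (fun T : H →L[ℂ] H => T x) h)
  exact DFunLike.coe_injective this

/-- The polar decomposition `T = S |T|` of an injective self-adjoint operator, together with the
(anti)commutation properties that its factors inherit. -/
theorem exists_sign {T : H →L[ℂ] H} (hT : IsSelfAdjoint T) (h0 : ∀ h, T h = 0 → h = 0) :
    ∃ S A : H →L[ℂ] H, IsSelfAdjoint S ∧ S * S = 1 ∧ A.IsPositive ∧ S * A = T ∧ A * S = T ∧
      (∀ X, X * T = T * X → X * S = S * X ∧ X * A = A * X) ∧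
      (∀ X, X * T = -(T * X) → X * S = -(S * X) ∧ X * A = A * X) := by
  have hAA : CFC.abs T * CFC.abs T = T * T := by rw [CFC.abs_mul_abs, hT.star_eq]
  have hApos : (CFC.abs T).IsPositive :=
    (ContinuousLinearMap.nonneg_iff_isPositive _).1 (CFC.abs_nonneg T)
  have hAsa : IsSelfAdjoint (CFC.abs T) := hApos.isSelfAdjoint
  -- `|T|` is a function of `T²`, and both `XT = TX` and `XT = -TX` imply that `X` commutes with
  -- `T²`.
  have hcomm : ∀ X, X * (T * T) = T * T * X → X * CFC.abs T = CFC.abs T * X := by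
    intro X hX
    have : Commute (star T * T) X := by
      rw [hT.star_eq]; exact hX.symm
    exact (this.cfcₙ_nnreal NNReal.sqrt).eq.symm
  generalize CFC.abs T = A at *
  have hnorm : ∀ h, ‖T h‖ = ‖A h‖ := by
    intro h
    have h1 : ⟪T h, T h⟫_ℂ = ⟪A h, A h⟫_ℂ := by
      have e1 := (ContinuousLinearMap.isSelfAdjoint_iff_isSymmetric.1 hT) (T h) h
      have e2 := (ContinuousLinearMap.isSelfAdjoint_iff_isSymmetric.1 hAsa) (A h) h
      have e3 : A (A h) = T (T h) := congrArg (fun X : H →L[ℂ] H => X h) hAA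
      simp only [ContinuousLinearMap.coe_coe] at e1 e2
      rw [← e1, ← e2, e3]
    rw [inner_self_eq_norm_sq_to_K, inner_self_eq_norm_sq_to_K] at h1
    have h2 : ‖T h‖ ^ 2 = ‖A h‖ ^ 2 := by exact_mod_cast h1
    exact (sq_eq_sq₀ (norm_nonneg _) (norm_nonneg _)).1 h2
  have hA0 : ∀ h, A h = 0 → h = 0 := fun h hh => h0 h (by
    rw [← norm_eq_zero, hnorm, hh, norm_zero])
  have hd : DenseRange A := denseRange_of_selfAdjoint_of_injective hAsa hA0
  have hAinj : ∀ X Y : H →L[ℂ] H, A * X = A * Y → X = Y := by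
    intro X Y h
    ext v
    have : A (X v) = A (Y v) := congrArg (fun T : H →L[ℂ] H => T v) h
    have := hA0 (X v - Y v) (by rw [map_sub, this, sub_self])
    exact sub_eq_zero.1 this
  -- On the dense range of `A` the map `A h ↦ T h` is well defined and isometric because `‖T h‖ = ‖A
  -- h‖`; `S` is its extension.
  obtain ⟨S, hS⟩ : ∃ S : H →L[ℂ] H, S * A = T :=
    ⟨LinearMap.extendOfNorm (T : H →ₗ[ℂ] H) (A : H →ₗ[ℂ] H), by
      ext h
      exact LinearMap.extendOfNorm_eq (f := (T : H →ₗ[ℂ] H)) (e := (A : H →ₗ[ℂ] H)) hd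
        ⟨1, fun x => by simpa using (hnorm x).le⟩ h⟩
  have hTA : T * A = A * T := hcomm T (by rw [mul_assoc])
  have hSA : A * S = T := by
    refine ContinuousLinearMap.eq_of_mul_denseRange hd ?_
    rw [mul_assoc, hS, hTA]
  have hS2 : S * S = 1 := by
    refine ContinuousLinearMap.eq_of_mul_denseRange hd
      (ContinuousLinearMap.eq_of_mul_denseRange hd ?_)
    calc S * S * A * A = S * (S * A) * A := by simp only [mul_assoc]
      _ = S * (T * A) := by rw [hS, mul_assoc]
      _ = (S * A) * T := by rw [hTA, mul_assoc]
      _ = 1 * A * A := by rw [hS, one_mul, hAA]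
  have hSsa : IsSelfAdjoint S := by
    refine hAinj _ _ ?_
    have := congrArg star hS
    rw [star_mul, hT.star_eq, hAsa.star_eq] at this
    rw [this, hSA]
  refine ⟨S, A, hSsa, hS2, hApos, hS, hSA, fun X hX => ?_, fun X hX => ?_⟩
  · have h1 : X * A = A * X := hcomm X (by rw [← mul_assoc, hX, mul_assoc, hX, mul_assoc])
    refine ⟨ContinuousLinearMap.eq_of_mul_denseRange hd ?_, h1⟩
    rw [mul_assoc, hS, hX, mul_assoc, h1, ← mul_assoc, hS]
  · have h1 : X * A = A * X := hcomm X (by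
      rw [← mul_assoc, hX, neg_mul, mul_assoc, hX, mul_neg, neg_neg, mul_assoc])
    refine ⟨ContinuousLinearMap.eq_of_mul_denseRange hd ?_, h1⟩
    rw [mul_assoc, hS, hX, neg_mul, mul_assoc, h1, ← mul_assoc, hS]

end Sign

/-- `E₀` carries no topology and `e` need not be injective: equality of norms already makes `f`
factor through the image of `e`. This is how maps defined on functions pass to `L²` classes. -/
theorem LinearMap.exists_linearIsometry_extend {E₀ E G : Type*} [AddCommGroup E₀] [Module ℂ E₀]
    [NormedAddCommGroup E] [NormedSpace ℂ E] [NormedAddCommGroup G] [NormedSpace ℂ G]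
    [CompleteSpace G] (f : E₀ →ₗ[ℂ] G) (e : E₀ →ₗ[ℂ] E) (he : DenseRange e)
    (h : ∀ x, ‖f x‖ = ‖e x‖) : ∃ g : E →ₗᵢ[ℂ] G, ∀ x, g (e x) = f x := by
  have hg : ∀ x, f.extendOfNorm e (e x) = f x := fun x =>
    LinearMap.extendOfNorm_eq he ⟨1, fun x => by rw [one_mul, h]⟩ x
  refine ⟨⟨(f.extendOfNorm e : E →L[ℂ] G), fun x => ?_⟩, hg⟩
  refine he.induction_on (p := fun x => ‖f.extendOfNorm e x‖ = ‖x‖) x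
    (isClosed_eq (by fun_prop) (by fun_prop)) fun a => ?_
  rw [hg, h]

/-! ### Isometries of `L²(N, dF)` and the odd reflection of an operator measure. -/

namespace OperatorMeasure

variable {N : Type*} [NormedAddCommGroup N] [InnerProductSpace ℂ N]

theorem inner_toL2 (F : OperatorMeasure N) {f g : ℝ → N} (hf : F.SqIntegrable f)
    (hg : F.SqIntegrable g) :
    ⟪F.toL2 f hf, F.toL2 g hg⟫_ℂ = ∫ x, ⟪f x, F.density x (g x)⟫_ℂ ∂F.base :=
  UniformSpace.Completion.inner_coe (𝕜 := ℂ) (E := F.PreL2) _ _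

theorem toL2_add (F : OperatorMeasure N) {f g : ℝ → N} (hf : F.SqIntegrable f)
    (hg : F.SqIntegrable g) :
    F.toL2 (f + g) (hf.add hg) = F.toL2 f hf + F.toL2 g hg :=
  UniformSpace.Completion.coe_add (α := F.PreL2) ⟨f, hf⟩ ⟨g, hg⟩

theorem toL2_smul (F : OperatorMeasure N) {f : ℝ → N} (c : ℂ) (hf : F.SqIntegrable f) :
    F.toL2 (c • f) (hf.smul c) = c • F.toL2 f hf :=
  UniformSpace.Completion.coe_smul (X := F.PreL2) c ⟨f, hf⟩

theorem SqIntegrable.congr {F : OperatorMeasure N} {f g : ℝ → N} (hf : F.SqIntegrable f)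
    (h : f =ᵐ[F.base] g) : F.SqIntegrable g :=
  ⟨hf.1.congr h, hf.2.congr (h.mono fun x hx => by simp only [hx])⟩

theorem toL2_congr (F : OperatorMeasure N) {f g : ℝ → N} (hf : F.SqIntegrable f)
    (hg : F.SqIntegrable g) (h : f =ᵐ[F.base] g) : F.toL2 f hf = F.toL2 g hg := by
  rw [← sub_eq_zero, ← inner_self_eq_zero (𝕜 := ℂ)]
  simp only [inner_sub_left, inner_sub_right, inner_toL2]
  have h1 : ∫ x, ⟪f x, F.density x (g x)⟫_ℂ ∂F.base = ∫ x, ⟪g x, F.density x (g x)⟫_ℂ ∂F.base :=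
    integral_congr_ae (h.mono fun x hx => by simp only [hx])
  have h2 : ∫ x, ⟪g x, F.density x (f x)⟫_ℂ ∂F.base = ∫ x, ⟪g x, F.density x (g x)⟫_ℂ ∂F.base :=
    integral_congr_ae (h.mono fun x hx => by simp only [hx])
  have h3 : ∫ x, ⟪f x, F.density x (f x)⟫_ℂ ∂F.base = ∫ x, ⟪g x, F.density x (g x)⟫_ℂ ∂F.base :=
    integral_congr_ae (h.mono fun x hx => by simp only [hx])
  rw [h1, h2, h3, sub_self]

theorem induction_L2 (F : OperatorMeasure N) {p : F.L2 → Prop} (hp : IsClosed {y | p y})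
    (h : ∀ f hf, p (F.toL2 f hf)) (y : F.L2) : p y :=
  UniformSpace.Completion.induction_on y hp fun f => h f.1 f.2

/-- A map on functions that preserves inner products extends to an isometry of `L²(N, dF)`. -/
theorem exists_linearIsometry (F : OperatorMeasure N) {E : Type*} [NormedAddCommGroup E]
    [InnerProductSpace ℂ E] [CompleteSpace E] (Φ : ∀ f, F.SqIntegrable f → E)
    (hadd : ∀ f g hf hg, Φ (f + g) (SqIntegrable.add hf hg) = Φ f hf + Φ g hg)
    (hsmul : ∀ (c : ℂ) f hf, Φ (c • f) (SqIntegrable.smul c hf) = c • Φ f hf)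
    (hinner : ∀ f hf, ⟪Φ f hf, Φ f hf⟫_ℂ = ∫ x, ⟪f x, F.density x (f x)⟫_ℂ ∂F.base) :
    ∃ X : F.L2 →ₗᵢ[ℂ] E, ∀ f hf, X (F.toL2 f hf) = Φ f hf := by
  let f₀ : F.PreL2 →ₗ[ℂ] E :=
    { toFun := fun f => Φ f.1 f.2
      map_add' := fun f g => hadd f.1 g.1 f.2 g.2
      map_smul' := fun c f => hsmul c f.1 f.2 }
  let e₀ : F.PreL2 →ₗ[ℂ] F.L2 := (UniformSpace.Completion.toComplL (𝕜 := ℂ) (E := F.PreL2))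
  obtain ⟨X, hX⟩ := f₀.exists_linearIsometry_extend e₀
    (UniformSpace.Completion.denseRange_coe (α := F.PreL2)) (fun f => by
      have h1 : ⟪f₀ f, f₀ f⟫_ℂ = ⟪e₀ f, e₀ f⟫_ℂ :=
        (hinner f.1 f.2).trans (F.inner_toL2 f.2 f.2).symm
      rw [inner_self_eq_norm_sq_to_K, inner_self_eq_norm_sq_to_K] at h1
      have h2 : ‖f₀ f‖ ^ 2 = ‖e₀ f‖ ^ 2 := by exact_mod_cast h1
      exact (sq_eq_sq₀ (norm_nonneg _) (norm_nonneg _)).1 h2)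
  exact ⟨X, fun f hf => hX ⟨f, hf⟩⟩

theorem ae_pos (F : OperatorMeasure N) (h0 : F.base (Set.Iic 0) = 0) : ∀ᵐ x ∂F.base, 0 < x := by
  rw [ae_iff]; simpa [Set.Iic] using h0

/-- The extension of `dF` on the positive half-line whose distribution function is odd. -/
def reflect (F : OperatorMeasure N) (h0 : F.base (Set.Iic 0) = 0) : OperatorMeasure N where
  dist t := if 0 ≤ t then F.dist t else -F.dist (-t)
  -- The two summands live on opposite half-lines, so one even density serves both.
  base := F.base + F.base.map (MeasurableEquiv.neg ℝ)
  density x := F.density |x|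
  base_finite := by
    have := F.base_finite
    infer_instance
  base_zero := by
    rw [Measure.add_apply, MeasurableEquiv.map_apply]
    simp [F.base_zero]
  density_nonneg x := F.density_nonneg _
  density_measurable v := (F.density_measurable v).comp_measurable measurable_norm
  density_integrable v w := by
    rw [integrable_add_measure, (MeasurableEquiv.neg ℝ).measurableEmbedding.integrable_map_iff]
    constructor
    · refine (F.density_integrable v w).congr ?_
      filter_upwards [F.ae_pos h0] with x hx
      rw [abs_of_pos hx]
    · refine (F.density_integrable v w).congr ?_
      filter_upwards [F.ae_pos h0] with x hx
      simp [abs_of_pos hx]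
  dist_of_nonneg t ht v w := by
    have := F.base_finite
    have h1 : F.base.map (MeasurableEquiv.neg ℝ) (Set.Ioc 0 t) = 0 := by
      rw [MeasurableEquiv.map_apply]
      refine measure_mono_null (fun x hx => ?_) h0
      simp at hx
      simp; linarith
    rw [if_pos ht, F.dist_of_nonneg t ht, Measure.restrict_add,
      Measure.restrict_eq_zero.2 h1, add_zero]
    refine setIntegral_congr_fun measurableSet_Ioc fun x hx => ?_
    simp only [abs_of_pos hx.1]
  dist_of_neg t ht v w := by
    have h1 : F.base (Set.Ico t 0) = 0 :=
      measure_mono_null (fun x hx => hx.2.le) h0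
    rw [if_neg ht.not_ge, Measure.restrict_add, Measure.restrict_eq_zero.2 h1, zero_add,
      (MeasurableEquiv.neg ℝ).measurableEmbedding.setIntegral_map]
    have h2 : (MeasurableEquiv.neg ℝ) ⁻¹' (Set.Ico t 0) = Set.Ioc 0 (-t) := by
      ext x
      change t ≤ -x ∧ -x < 0 ↔ 0 < x ∧ x ≤ -t
      constructor <;> intro h <;> constructor <;> linarith [h.1, h.2]
    rw [h2, neg_apply, inner_neg_right, F.dist_of_nonneg _ (by linarith)]
    congr 1
    refine setIntegral_congr_fun measurableSet_Ioc fun x hx => ?_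
    simp [abs_of_pos hx.1]

section Reflect

variable (F : OperatorMeasure N) (h0 : F.base (Set.Iic 0) = 0)

theorem reflect_integrable_iff {φ : ℝ → ℂ} :
    Integrable φ (F.reflect h0).base ↔
      Integrable φ F.base ∧ Integrable (fun x => φ (-x)) F.base := by
  change Integrable φ (F.base + F.base.map (MeasurableEquiv.neg ℝ)) ↔ _
  rw [integrable_add_measure, (MeasurableEquiv.neg ℝ).measurableEmbedding.integrable_map_iff]
  rfl

theorem reflect_integral {φ : ℝ → ℂ} (hφ : Integrable φ (F.reflect h0).base) :
    ∫ x, φ x ∂(F.reflect h0).base = ∫ x, φ x ∂F.base + ∫ x, φ (-x) ∂F.base := by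
  change ∫ x, φ x ∂(F.base + F.base.map (MeasurableEquiv.neg ℝ)) = _
  rw [integral_add_measure hφ.left_of_add_measure hφ.right_of_add_measure,
    (MeasurableEquiv.neg ℝ).measurableEmbedding.integral_map]
  rfl

theorem reflect_sqIntegrable_iff {f : ℝ → N} :
    (F.reflect h0).SqIntegrable f ↔ F.SqIntegrable f ∧ F.SqIntegrable fun x => f (-x) := by
  have h1 : AEStronglyMeasurable f (F.reflect h0).base ↔
      AEStronglyMeasurable f F.base ∧ AEStronglyMeasurable (fun x => f (-x)) F.base := by
    change AEStronglyMeasurable f (F.base + F.base.map (MeasurableEquiv.neg ℝ)) ↔ _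
    rw [aestronglyMeasurable_add_measure_iff,
      (MeasurableEquiv.neg ℝ).measurableEmbedding.aestronglyMeasurable_map_iff]
    rfl
  have h2 : Integrable (fun x => ⟪f x, (F.reflect h0).density x (f x)⟫_ℂ) (F.reflect h0).base ↔
      Integrable (fun x => ⟪f x, F.density x (f x)⟫_ℂ) F.base ∧
      Integrable (fun x => ⟪f (-x), F.density x (f (-x))⟫_ℂ) F.base := by
    rw [reflect_integrable_iff]
    refine and_congr (integrable_congr ?_) (integrable_congr ?_)
    · filter_upwards [F.ae_pos h0] with x hx
      simp only [reflect, abs_of_pos hx]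
    · filter_upwards [F.ae_pos h0] with x hx
      simp only [reflect, abs_neg, abs_of_pos hx]
  unfold SqIntegrable
  rw [h1, h2]
  tauto

/-- A function on the line is split into its two halves, the negative one reflected. Square
integrals add up, so this is an isometry. -/
theorem exists_reflect_equiv :
    ∃ Θ : (F.reflect h0).L2 ≃ₗᵢ[ℂ] WithLp 2 (F.L2 × F.L2),
      ∀ f (hf : (F.reflect h0).SqIntegrable f), Θ ((F.reflect h0).toL2 f hf) =
        WithLp.toLp 2 (F.toL2 f ((F.reflect_sqIntegrable_iff h0).1 hf).1,
          F.toL2 (fun x => f (-x)) ((F.reflect_sqIntegrable_iff h0).1 hf).2) := by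
  obtain ⟨X, hX⟩ := (F.reflect h0).exists_linearIsometry (E := WithLp 2 (F.L2 × F.L2))
    (fun f hf => WithLp.toLp 2 (F.toL2 f ((F.reflect_sqIntegrable_iff h0).1 hf).1,
          F.toL2 (fun x => f (-x)) ((F.reflect_sqIntegrable_iff h0).1 hf).2))
    (fun f g hf hg => by
      rw [← WithLp.toLp_add, Prod.mk_add_mk, ← toL2_add, ← toL2_add]; rfl)
    (fun c f hf => by
      rw [← WithLp.toLp_smul, Prod.smul_mk, ← toL2_smul, ← toL2_smul]; rfl)
    (fun f hf => by
      rw [WithLp.prod_inner_apply]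
      simp only [inner_toL2]
      rw [F.reflect_integral h0 hf.2]
      congr 1
      · refine integral_congr_ae ?_
        filter_upwards [F.ae_pos h0] with x hx
        simp only [reflect, abs_of_pos hx]
      · refine integral_congr_ae ?_
        filter_upwards [F.ae_pos h0] with x hx
        simp only [reflect, abs_neg, abs_of_pos hx])
  have hcl : IsClosed (Set.range X) := X.isometry.isClosedEmbedding.isClosed_range
  -- Pairs of functions are reached by gluing. As the range of an isometry is closed, density in
  -- each coordinate then gives surjectivity.
  have hfun : ∀ f₁ h₁ f₂ h₂, WithLp.toLp 2 (F.toL2 f₁ h₁, F.toL2 f₂ h₂) ∈ Set.range X := by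
    intro f₁ h₁ f₂ h₂
    have e1 : f₁ =ᵐ[F.base] fun x => if 0 < x then f₁ x else f₂ (-x) := by
      filter_upwards [F.ae_pos h0] with x hx
      simp [hx]
    have e2 : f₂ =ᵐ[F.base] fun x => if 0 < -x then f₁ (-x) else f₂ (- -x) := by
      filter_upwards [F.ae_pos h0] with x hx
      simp [hx.le]
    have hs : (F.reflect h0).SqIntegrable fun x => if 0 < x then f₁ x else f₂ (-x) :=
      (F.reflect_sqIntegrable_iff h0).2 ⟨h₁.congr e1, h₂.congr e2⟩
    refine ⟨_, (hX _ hs).trans ?_⟩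
    rw [F.toL2_congr h₁ (h₁.congr e1) e1, F.toL2_congr h₂ (h₂.congr e2) e2]
  have hsurj : Function.Surjective X := by
    intro p
    have h1 : ∀ a f₂ h₂, WithLp.toLp 2 (a, F.toL2 f₂ h₂) ∈ Set.range X := fun a f₂ h₂ =>
      F.induction_L2 (p := fun a => WithLp.toLp 2 (a, F.toL2 f₂ h₂) ∈ Set.range X)
        (hcl.preimage (by fun_prop)) (fun f₁ h₁ => hfun f₁ h₁ f₂ h₂) a
    exact F.induction_L2 (p := fun b => WithLp.toLp 2 (p.fst, b) ∈ Set.range X)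
        (hcl.preimage (by fun_prop)) (fun f₂ h₂ => h1 _ f₂ h₂) p.snd
  exact ⟨LinearIsometryEquiv.ofSurjective X hsurj, hX⟩

end Reflect

end OperatorMeasure

/-! ### Scalar spectral measures from the continuous functional calculus. -/

section FunctionalCalculus

variable {K : Type*} [NormedAddCommGroup K] [InnerProductSpace ℂ K] [CompleteSpace K]

/-- The continuous functional calculus of a self-adjoint operator for complex valued functions on
the real line. -/
def selfAdjointCalculus (C : K →L[ℂ] K) (φ : ℝ → ℂ) : K →L[ℂ] K :=
  cfc (fun z : ℂ => φ z.re) C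

theorem continuousOn_comp_re {φ : ℝ → ℂ} (hφ : Continuous φ) (s : Set ℂ) :
    ContinuousOn (fun z : ℂ => φ z.re) s :=
  (hφ.comp Complex.continuous_re).continuousOn

variable {C : K →L[ℂ] K} (hC : IsSelfAdjoint C)

theorem selfAdjointCalculus_add {φ ψ : ℝ → ℂ} (hφ : Continuous φ) (hψ : Continuous ψ) :
    selfAdjointCalculus C (fun x => φ x + ψ x) =
      selfAdjointCalculus C φ + selfAdjointCalculus C ψ :=
  cfc_add (a := C) _ _ (continuousOn_comp_re hφ _) (continuousOn_comp_re hψ _)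

theorem selfAdjointCalculus_mul {φ ψ : ℝ → ℂ} (hφ : Continuous φ) (hψ : Continuous ψ) :
    selfAdjointCalculus C (fun x => φ x * ψ x) =
      selfAdjointCalculus C φ * selfAdjointCalculus C ψ :=
  cfc_mul (a := C) _ _ (continuousOn_comp_re hφ _) (continuousOn_comp_re hψ _)

theorem selfAdjointCalculus_const_mul (c : ℂ) {φ : ℝ → ℂ} (hφ : Continuous φ) :
    selfAdjointCalculus C (fun x => c * φ x) = c • selfAdjointCalculus C φ :=
  cfc_const_mul (a := C) c _ (continuousOn_comp_re hφ _)

theorem selfAdjointCalculus_star (φ : ℝ → ℂ) :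
    selfAdjointCalculus C (fun x => star (φ x)) = star (selfAdjointCalculus C φ) :=
  cfc_star (a := C) _

include hC in
theorem selfAdjointCalculus_one : selfAdjointCalculus C (fun _ => 1) = 1 :=
  cfc_const_one ℂ C hC.isStarNormal

include hC in
theorem selfAdjointCalculus_ofReal (φ : ℝ → ℝ) :
    selfAdjointCalculus C (fun x => (φ x : ℂ)) = cfc φ C :=
  (cfc_real_eq_complex φ hC).symm

include hC in
theorem commute_selfAdjointCalculus {P : K →L[ℂ] K} (h : Commute C P) (φ : ℝ → ℂ) :
    Commute (selfAdjointCalculus C φ) P :=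
  h.cfc (by rwa [hC.star_eq]) _

theorem inner_selfAdjointCalculus_left (φ : ℝ → ℂ) (v w : K) :
    ⟪selfAdjointCalculus C φ v, w⟫_ℂ = ⟪v, selfAdjointCalculus C (fun x => star (φ x)) w⟫_ℂ := by
  rw [selfAdjointCalculus_star, ContinuousLinearMap.star_eq_adjoint,
    ContinuousLinearMap.adjoint_inner_right]

include hC in
-- Riesz–Markov on the compact spectrum, applied to the positive functional `f ↦ ⟨v, f(C) v⟩`; the
-- measure is then pushed forward to the line.
theorem exists_spectral_measure_real (v : K) :
    ∃ μ : Measure ℝ, IsFiniteMeasure μ ∧ μ (spectrum ℝ C)ᶜ = 0 ∧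
      ∀ φ : ℝ → ℝ, Continuous φ → Integrable φ μ ∧
        ((∫ x, φ x ∂μ : ℝ) : ℂ) = ⟪v, cfc φ C v⟫_ℂ := by
  let Λ₀ : CompactlySupportedContinuousMap (spectrum ℝ C) ℝ →ₗ[ℝ] ℝ :=
    { toFun := fun f => (⟪v, cfcHom hC (f : C(spectrum ℝ C, ℝ)) v⟫_ℂ).re
      map_add' := fun f g => by
        have : ((f + g : CompactlySupportedContinuousMap (spectrum ℝ C) ℝ) :
          C(spectrum ℝ C, ℝ)) = (f : C(spectrum ℝ C, ℝ)) + g := rfl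
        rw [this, map_add, add_apply, inner_add_right, Complex.add_re]
      map_smul' := fun c f => by
        have : ((c • f : CompactlySupportedContinuousMap (spectrum ℝ C) ℝ) :
          C(spectrum ℝ C, ℝ)) = c • (f : C(spectrum ℝ C, ℝ)) := rfl
        rw [this, map_smul, smul_apply, inner_smul_right_eq_smul]
        simp }
  have hpos : ∀ f, 0 ≤ f → 0 ≤ Λ₀ f := by
    intro f hf
    have h1 : 0 ≤ cfcHom hC (f : C(spectrum ℝ C, ℝ)) := (cfcHom_nonneg_iff hC).2 hf
    exact ((ContinuousLinearMap.nonneg_iff_isPositive _).1 h1).re_inner_nonneg_right v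
  let Λ := PositiveLinearMap.mk₀ Λ₀ hpos
  have hsp : MeasurableSet (spectrum ℝ C) := (spectrum.isClosed C).measurableSet
  refine ⟨(RealRMK.rieszMeasure Λ).map Subtype.val, inferInstance, ?_, fun φ hφ => ?_⟩
  · rw [Measure.map_apply measurable_subtype_coe hsp.compl]
    convert measure_empty (μ := RealRMK.rieszMeasure Λ)
    ext x; simp
  · have hme := MeasurableEmbedding.subtype_coe hsp
    let f : C(spectrum ℝ C, ℝ) := ⟨fun x => φ x, hφ.comp continuous_subtype_val⟩
    have h1 := RealRMK.integral_rieszMeasure Λ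
      (CompactlySupportedContinuousMap.continuousMapEquiv f)
    have h2 : cfc φ C = cfcHom hC f := cfc_apply φ C hC hφ.continuousOn
    constructor
    · rw [hme.integrable_map_iff]
      exact f.continuous.integrable_of_hasCompactSupport (HasCompactSupport.of_compactSpace _)
    · rw [hme.integral_map]
      have h3 : ∫ x : spectrum ℝ C, φ x ∂(RealRMK.rieszMeasure Λ) = (⟪v, cfc φ C v⟫_ℂ).re := by
        rw [h2]; exact h1
      rw [h3]
      have h4 := (cfc_predicate φ C : IsSelfAdjoint (cfc φ C))
      apply Complex.ext
      · simp
      · simp only [Complex.ofReal_im]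
        have h5 := (ContinuousLinearMap.isSelfAdjoint_iff_isSymmetric.1 h4) v v
        simp only [ContinuousLinearMap.coe_coe] at h5
        have h6 := inner_conj_symm (𝕜 := ℂ) v (cfc φ C v)
        rw [h5] at h6
        exact (Complex.conj_eq_iff_im.1 h6).symm

include hC in
theorem exists_spectral_measure (v : K) :
    ∃ μ : Measure ℝ, IsFiniteMeasure μ ∧ μ (spectrum ℝ C)ᶜ = 0 ∧
      ∀ φ : ℝ → ℂ, Continuous φ → ∫ x, φ x ∂μ = ⟪v, selfAdjointCalculus C φ v⟫_ℂ := by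
  obtain ⟨μ, h1, h2, h3⟩ := exists_spectral_measure_real hC v
  refine ⟨μ, h1, h2, fun φ hφ => ?_⟩
  have hre : Continuous fun x => (φ x).re := Complex.continuous_re.comp hφ
  have him : Continuous fun x => (φ x).im := Complex.continuous_im.comp hφ
  have e : φ = fun x => ((φ x).re : ℂ) + Complex.I * ((φ x).im : ℂ) := by
    funext x
    rw [mul_comm, Complex.re_add_im]
  have i1 := (h3 _ hre).1.ofReal (𝕜 := ℂ)
  have i2 := (h3 _ him).1.ofReal (𝕜 := ℂ)
  rw [e, selfAdjointCalculus_add (by fun_prop) (by fun_prop),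
    selfAdjointCalculus_const_mul _ (by fun_prop), selfAdjointCalculus_ofReal hC,
    selfAdjointCalculus_ofReal hC, add_apply, smul_apply, inner_add_right, inner_smul_right,
    ← (h3 _ hre).2, ← (h3 _ him).2]
  refine (integral_add i1 (i2.const_mul _)).trans ?_
  rw [integral_const_mul]
  congr 1
  · exact integral_ofReal
  · congr 1
    exact integral_ofReal

/-- The scalar spectral measure of the vector `v`. -/
def spectralMeasure (v : K) : Measure ℝ := (exists_spectral_measure hC v).choose

instance (v : K) : IsFiniteMeasure (spectralMeasure hC v) :=
  (exists_spectral_measure hC v).choose_spec.1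

theorem spectralMeasure_compl_spectrum (v : K) : spectralMeasure hC v (spectrum ℝ C)ᶜ = 0 :=
  (exists_spectral_measure hC v).choose_spec.2.1

theorem integral_spectralMeasure (v : K) {φ : ℝ → ℂ} (hφ : Continuous φ) :
    ∫ x, φ x ∂(spectralMeasure hC v) = ⟪v, selfAdjointCalculus C φ v⟫_ℂ :=
  (exists_spectral_measure hC v).choose_spec.2.2 φ hφ

open scoped BoundedContinuousFunction

/-- `‖φ(C) v‖² = ⟨v, |φ|²(C) v⟩ = ∫ |φ|²`, and bounded continuous functions are dense in `L²` of a
finite measure. -/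
theorem exists_cyclic_isometry (v : K) :
    ∃ V : Lp ℂ 2 (spectralMeasure hC v) →ₗᵢ[ℂ] K, ∀ φ : ℝ →ᵇ ℂ,
      V (BoundedContinuousFunction.toLp 2 _ ℂ φ) = selfAdjointCalculus C φ v := by
  let f : (ℝ →ᵇ ℂ) →ₗ[ℂ] K :=
    { toFun := fun φ => selfAdjointCalculus C φ v
      map_add' := fun φ ψ => by
        have := selfAdjointCalculus_add (C := C) φ.continuous ψ.continuous
        exact congrArg (fun T : K →L[ℂ] K => T v) this
      map_smul' := fun c φ => by
        have := selfAdjointCalculus_const_mul (C := C) c φ.continuous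
        exact congrArg (fun T : K →L[ℂ] K => T v) this }
  let e : (ℝ →ᵇ ℂ) →ₗ[ℂ] Lp ℂ 2 (spectralMeasure hC v) :=
    ((BoundedContinuousFunction.toLp 2 (spectralMeasure hC v) ℂ :
      (ℝ →ᵇ ℂ) →L[ℂ] Lp ℂ 2 (spectralMeasure hC v)) :
      (ℝ →ᵇ ℂ) →ₗ[ℂ] Lp ℂ 2 (spectralMeasure hC v))
  refine f.exists_linearIsometry_extend e
    (BoundedContinuousFunction.toLp_denseRange ℂ (spectralMeasure hC v) ℂ (by norm_num)) ?_
  intro φ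
  have h1 : ⟪f φ, f φ⟫_ℂ = ⟪e φ, e φ⟫_ℂ := by
    have e1 : ⟪f φ, f φ⟫_ℂ = ⟪v, selfAdjointCalculus C (fun x => star (φ x) * φ x) v⟫_ℂ := by
      rw [selfAdjointCalculus_mul (by fun_prop) (by fun_prop)]
      exact inner_selfAdjointCalculus_left _ _ _
    rw [e1, ← integral_spectralMeasure hC v (by fun_prop), L2.inner_def]
    refine integral_congr_ae ?_
    filter_upwards [BoundedContinuousFunction.coeFn_toLp 2 (spectralMeasure hC v) ℂ φ] with x hx
    change _ = ⟪(BoundedContinuousFunction.toLp 2 (spectralMeasure hC v) ℂ φ) x,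
      (BoundedContinuousFunction.toLp 2 (spectralMeasure hC v) ℂ φ) x⟫_ℂ
    rw [hx]
    exact mul_comm _ _
  rw [inner_self_eq_norm_sq_to_K, inner_self_eq_norm_sq_to_K] at h1
  have h2 : ‖f φ‖ ^ 2 = ‖e φ‖ ^ 2 := by exact_mod_cast h1
  exact (sq_eq_sq₀ (norm_nonneg _) (norm_nonneg _)).1 h2

end FunctionalCalculus

/-! ### Multiplication by strongly measurable operator functions. -/

section Multiplication

variable {E G : Type*} [NormedAddCommGroup E] [NormedSpace ℂ E] [NormedAddCommGroup G]
  [NormedSpace ℂ G]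

/-- For a simple `f` the function is a finite sum of indicators times `R x v`; the general case is a
pointwise limit, each `R x` being continuous. -/
theorem StronglyMeasurable.clm_apply_of_forall {R : ℝ → E →L[ℂ] G}
    (hR : ∀ v, StronglyMeasurable fun x => R x v) {f : ℝ → E} (hf : StronglyMeasurable f) :
    StronglyMeasurable fun x => R x (f x) := by
  refine stronglyMeasurable_of_tendsto Filter.atTop
    (f := fun n x => R x (hf.approx n x)) (fun n => ?_) ?_
  · have : (fun x => R x (hf.approx n x)) = fun x =>
        ∑ v ∈ (hf.approx n).range, ((hf.approx n) ⁻¹' {v}).indicator (fun x => R x v) x := by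
      funext x
      rw [Finset.sum_eq_single (hf.approx n x)]
      · simp
      · intro v _ hv
        simp [Set.indicator, Ne.symm hv]
      · intro h
        exact absurd (SimpleFunc.mem_range_self _ x) h
    rw [this]
    exact Finset.stronglyMeasurable_fun_sum _ fun v _ =>
      (hR v).indicator ((hf.approx n).measurableSet_fiber v)
  · rw [tendsto_pi_nhds]
    exact fun x => ((R x).continuous.tendsto _).comp (hf.tendsto_approx x)

theorem AEStronglyMeasurable.clm_apply_of_forall {μ : Measure ℝ} {R : ℝ → E →L[ℂ] G}
    (hR : ∀ v, StronglyMeasurable fun x => R x v) {f : ℝ → E} (hf : AEStronglyMeasurable f μ) :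
    AEStronglyMeasurable (fun x => R x (f x)) μ := by
  obtain ⟨g, hg, hfg⟩ := hf
  exact ⟨_, StronglyMeasurable.clm_apply_of_forall hR hg, hfg.mono fun x hx => by simp only [hx]⟩

/-- A bounded strongly measurable operator function acts on `L²`. -/
theorem exists_multiplication (μ : Measure ℝ) {R : ℝ → E →L[ℂ] G}
    (hR : ∀ v, StronglyMeasurable fun x => R x v) {c : ℝ} (hc : ∀ x, ‖R x‖ ≤ c) :
    ∃ T : Lp E 2 μ →L[ℂ] Lp G 2 μ, ∀ g, T g =ᵐ[μ] fun x => R x (g x) := by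
  have hmem : ∀ g : Lp E 2 μ, MemLp (fun x => R x (g x)) 2 μ := fun g =>
    (Lp.memLp g).of_le_mul (AEStronglyMeasurable.clm_apply_of_forall hR (Lp.aestronglyMeasurable g))
      (Filter.Eventually.of_forall fun x => (R x).le_of_opNorm_le (hc x) _)
  refine ⟨LinearMap.mkContinuous
    { toFun := fun g => (hmem g).toLp _
      map_add' := fun g h => ?_
      map_smul' := fun a g => ?_ } c fun g => ?_, fun g => (hmem g).coeFn_toLp⟩
  · rw [← MemLp.toLp_add, MemLp.toLp_eq_toLp_iff]
    filter_upwards [Lp.coeFn_add g h] with x hx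
    rw [hx]
    exact map_add _ _ _
  · rw [RingHom.id_apply, ← MemLp.toLp_const_smul, MemLp.toLp_eq_toLp_iff]
    filter_upwards [Lp.coeFn_smul a g] with x hx
    rw [hx]
    exact map_smul _ _ _
  · refine Lp.norm_le_mul_norm_of_ae_le_mul ?_
    filter_upwards [(hmem g).coeFn_toLp] with x hx
    simp only [LinearMap.coe_mk, AddHom.coe_mk, hx]
    exact (R x).le_of_opNorm_le (hc x) _

open scoped BoundedContinuousFunction

theorem exists_multiplication_boundedContinuous (μ : Measure ℝ) (φ : ℝ →ᵇ ℂ) :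
    ∃ T : Lp E 2 μ →L[ℂ] Lp E 2 μ, ∀ g, T g =ᵐ[μ] fun x => φ x • g x :=
  exists_multiplication μ (R := fun x => φ x • ContinuousLinearMap.id ℂ E)
    (fun v => φ.continuous.stronglyMeasurable.smul_const v) (c := ‖φ‖) fun x => by
      refine (norm_smul_le (φ x) (ContinuousLinearMap.id ℂ E)).trans ?_
      calc ‖φ x‖ * ‖ContinuousLinearMap.id ℂ E‖ ≤ ‖φ‖ * 1 := by
            gcongr
            · exact φ.norm_coe_le_norm x
            · exact ContinuousLinearMap.norm_id_le
        _ = ‖φ‖ := mul_one _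

end Multiplication

/-! ### Orthogonal decomposition into cyclic subspaces. -/

section Cyclic

open scoped BoundedContinuousFunction

variable {K : Type*} [NormedAddCommGroup K] [InnerProductSpace ℂ K] [CompleteSpace K]
  {C : K →L[ℂ] K} (hC : IsSelfAdjoint C)

theorem inner_selfAdjointCalculus_selfAdjointCalculus (φ ψ : ℝ →ᵇ ℂ) (v w : K) :
    ⟪selfAdjointCalculus C φ v, selfAdjointCalculus C ψ w⟫_ℂ =
      ⟪v, selfAdjointCalculus C (star φ * ψ : ℝ →ᵇ ℂ) w⟫_ℂ := by
  have : ((star φ * ψ : ℝ →ᵇ ℂ) : ℝ → ℂ) = fun x => star (φ x) * ψ x := by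
    funext x; simp
  rw [this, selfAdjointCalculus_mul (by fun_prop) (by fun_prop), inner_selfAdjointCalculus_left]
  rfl

theorem selfAdjointCalculus_mul_apply (φ ψ : ℝ →ᵇ ℂ) (v : K) :
    selfAdjointCalculus C (φ * ψ : ℝ →ᵇ ℂ) v =
      selfAdjointCalculus C φ (selfAdjointCalculus C ψ v) := by
  have : ((φ * ψ : ℝ →ᵇ ℂ) : ℝ → ℂ) = fun x => φ x * ψ x := by
    funext x; simp
  rw [this, selfAdjointCalculus_mul (by fun_prop) (by fun_prop)]
  rfl

/-- The closed invariant subspace generated by the first `n` vectors of a sequence. -/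
def cyclicSpan (C : K →L[ℂ] K) (d : ℕ → K) (n : ℕ) : Submodule ℂ K :=
  (Submodule.span ℂ {x | ∃ j < n, ∃ φ : ℝ →ᵇ ℂ, x = selfAdjointCalculus C φ (d j)}).topologicalClosure

instance (d : ℕ → K) (n : ℕ) : CompleteSpace (cyclicSpan C d n) :=
  (Submodule.isClosed_topologicalClosure _).completeSpace_coe

theorem cyclicSpan_le {d : ℕ → K} {n : ℕ} {L : Submodule ℂ K} (hL : IsClosed (L : Set K))
    (h : ∀ j < n, ∀ φ : ℝ →ᵇ ℂ, selfAdjointCalculus C φ (d j) ∈ L) : cyclicSpan C d n ≤ L :=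
  Submodule.topologicalClosure_minimal _ (Submodule.span_le.2 (by
    rintro x ⟨j, hj, φ, rfl⟩
    exact h j hj φ)) hL

theorem mem_cyclicSpan (d : ℕ → K) {n j : ℕ} (hj : j < n) (φ : ℝ →ᵇ ℂ) :
    selfAdjointCalculus C φ (d j) ∈ cyclicSpan C d n :=
  Submodule.le_topologicalClosure
    (Submodule.span ℂ {x | ∃ j < n, ∃ φ : ℝ →ᵇ ℂ, x = selfAdjointCalculus C φ (d j)})
    (Submodule.subset_span ⟨j, hj, φ, rfl⟩)

theorem isClosed_cyclicSpan (d : ℕ → K) (n : ℕ) : IsClosed (cyclicSpan C d n : Set K) :=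
  Submodule.isClosed_topologicalClosure _

theorem cyclicSpan_mono (d : ℕ → K) {m n : ℕ} (h : m ≤ n) :
    cyclicSpan C d m ≤ cyclicSpan C d n :=
  cyclicSpan_le (isClosed_cyclicSpan d n) fun _ hj φ =>
    mem_cyclicSpan d (hj.trans_le h) φ

theorem selfAdjointCalculus_mem_cyclicSpan (d : ℕ → K) (n : ℕ) (φ : ℝ →ᵇ ℂ) {x : K}
    (hx : x ∈ cyclicSpan C d n) : selfAdjointCalculus C φ x ∈ cyclicSpan C d n := by
  have : cyclicSpan C d n ≤
      (cyclicSpan C d n).comap (selfAdjointCalculus C φ : K →ₗ[ℂ] K) := by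
    refine cyclicSpan_le ?_ fun j hj ψ => ?_
    · exact (isClosed_cyclicSpan d n).preimage
        (selfAdjointCalculus C φ).continuous
    · change selfAdjointCalculus C φ (selfAdjointCalculus C ψ (d j)) ∈ cyclicSpan C d n
      rw [← selfAdjointCalculus_mul_apply]
      exact mem_cyclicSpan d hj _
  exact this hx

include hC in
theorem selfAdjointCalculus_one_apply (v : K) :
    selfAdjointCalculus C (1 : ℝ →ᵇ ℂ) v = v := by
  have := selfAdjointCalculus_one hC
  exact congrArg (fun T : K →L[ℂ] K => T v) this

include hC in
/-- A separable Hilbert space is the orthogonal sum of countably many cyclic subspaces. -/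
theorem exists_cyclic_decomposition [TopologicalSpace.SeparableSpace K] :
    ∃ w : ℕ → K,
      (∀ i j, i ≠ j → ∀ φ ψ : ℝ →ᵇ ℂ,
        ⟪selfAdjointCalculus C φ (w i), selfAdjointCalculus C ψ (w j)⟫_ℂ = 0) ∧
      ∀ h, (∀ j, ∀ φ : ℝ →ᵇ ℂ, ⟪selfAdjointCalculus C φ (w j), h⟫_ℂ = 0) → h = 0 := by
  -- Gram–Schmidt with cyclic subspaces in place of lines: `w n` is the part of `d n` orthogonal to
  -- the cyclic subspaces of the earlier `d j`.
  let d := TopologicalSpace.denseSeq K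
  let p : ℕ → K := fun n => (cyclicSpan C d n).starProjection (d n)
  let w : ℕ → K := fun n => d n - p n
  have hp : ∀ n, p n ∈ cyclicSpan C d n := fun n => Submodule.starProjection_apply_mem _ _
  have hd : ∀ n, d n ∈ cyclicSpan C d (n + 1) := fun n => by
    rw [← selfAdjointCalculus_one_apply hC (d n)]
    exact mem_cyclicSpan d n.lt_succ_self 1
  have hw : ∀ n, w n ∈ cyclicSpan C d (n + 1) := fun n =>
    Submodule.sub_mem _ (hd n) (cyclicSpan_mono d n.le_succ (hp n))
  have hw' : ∀ n, ∀ x ∈ cyclicSpan C d n, ⟪x, w n⟫_ℂ = 0 := fun n =>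
    (Submodule.mem_orthogonal _ _).1 (Submodule.sub_starProjection_mem_orthogonal (d n))
  have hlt : ∀ i j, i < j → ∀ φ ψ : ℝ →ᵇ ℂ,
      ⟪selfAdjointCalculus C φ (w i), selfAdjointCalculus C ψ (w j)⟫_ℂ = 0 := by
    intro i j hij φ ψ
    -- All functions are moved onto `w i`, which stays inside an invariant subspace orthogonal to `w
    -- j`.
    rw [← inner_conj_symm, inner_selfAdjointCalculus_selfAdjointCalculus, inner_conj_symm]
    exact hw' j _ (selfAdjointCalculus_mem_cyclicSpan d j _ (cyclicSpan_mono d hij (hw i)))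
  refine ⟨w, fun i j hij φ ψ => ?_, fun h hh => ?_⟩
  · rcases lt_or_gt_of_ne hij with h | h
    · exact hlt i j h φ ψ
    · rw [← inner_conj_symm, hlt j i h, map_zero]
  -- By induction `h` is orthogonal to every span: `d j = w j + p j`, where `p j` lies in the span
  -- of the earlier vectors.
  · have h1 : ∀ n, ∀ x ∈ cyclicSpan C d n, ⟪x, h⟫_ℂ = 0 := by
      intro n
      induction n with
      | zero =>
        intro x hx
        have : cyclicSpan C d 0 ≤ (⊥ : Submodule ℂ K) :=
          cyclicSpan_le (by simp) (by simp)
        rw [(Submodule.mem_bot ℂ).1 (this hx), inner_zero_left]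
      | succ n ih =>
        have : cyclicSpan C d (n + 1) ≤ (ℂ ∙ h)ᗮ := by
          refine cyclicSpan_le (Submodule.isClosed_orthogonal _) fun j hj φ => ?_
          rw [Submodule.mem_orthogonal_singleton_iff_inner_left]
          rcases Nat.lt_succ_iff_lt_or_eq.1 hj with hj | rfl
          · exact ih _ (mem_cyclicSpan d hj φ)
          · have e : d j = w j + p j := (sub_add_cancel _ _).symm
            rw [e, map_add, inner_add_left, hh, zero_add]
            exact ih _ (selfAdjointCalculus_mem_cyclicSpan d j φ (hp j))
        exact fun x hx => Submodule.mem_orthogonal_singleton_iff_inner_left.1 (this hx)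
    have h2 : ∀ x, ⟪x, h⟫_ℂ = 0 := by
      intro x
      refine (TopologicalSpace.denseRange_denseSeq K).induction_on (p := fun x => ⟪x, h⟫_ℂ = 0) x
        (isClosed_eq (by fun_prop) continuous_const) fun n => h1 _ _ (hd n)
    exact inner_self_eq_zero.1 (h2 h)

/-- On the dense set of bounded continuous functions this is multiplicativity of the calculus.
Stating it with an almost everywhere equality keeps the multiplication operator out of the
statement. -/
theorem cyclic_isometry_mul {v : K} {V : Lp ℂ 2 (spectralMeasure hC v) →ₗᵢ[ℂ] K}
    (hV : ∀ φ : ℝ →ᵇ ℂ,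
      V (BoundedContinuousFunction.toLp 2 _ ℂ φ) = selfAdjointCalculus C φ v)
    (φ : ℝ →ᵇ ℂ) {g h : Lp ℂ 2 (spectralMeasure hC v)}
    (hgh : g =ᵐ[spectralMeasure hC v] fun x => φ x * h x) :
    V g = selfAdjointCalculus C φ (V h) := by
  obtain ⟨T, hT⟩ := exists_multiplication_boundedContinuous (E := ℂ) (spectralMeasure hC v) φ
  have e : g = T h := Lp.ext (hgh.trans (hT h).symm)
  rw [e]
  refine (BoundedContinuousFunction.toLp_denseRange ℂ (spectralMeasure hC v) ℂ
    (by norm_num : (2 : ENNReal) ≠ ⊤)).induction_on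
    (p := fun h => V (T h) = selfAdjointCalculus C φ (V h)) h
    (isClosed_eq (by fun_prop) (by fun_prop)) fun ψ => ?_
  rw [hV, ← selfAdjointCalculus_mul_apply, ← hV]
  congr 1
  refine Lp.ext ?_
  filter_upwards [hT (BoundedContinuousFunction.toLp 2 _ ℂ ψ),
    BoundedContinuousFunction.coeFn_toLp 2 (spectralMeasure hC v) ℂ ψ,
    BoundedContinuousFunction.coeFn_toLp 2 (spectralMeasure hC v) ℂ (φ * ψ)] with x h1 h2 h3
  rw [h1, h2, h3]
  rfl

include hC in
/-- The spectral representation of a self-adjoint operator on an orthogonal sum of spaces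
`L²(μ n)`. -/
theorem exists_spectral_representation [TopologicalSpace.SeparableSpace K] :
    ∃ (μ : ℕ → Measure ℝ) (_ : ∀ n, IsFiniteMeasure (μ n)) (V : ∀ n, Lp ℂ 2 (μ n) →ₗᵢ[ℂ] K),
      (∀ n, μ n (spectrum ℝ C)ᶜ = 0) ∧ IsHilbertSum ℂ (fun n => Lp ℂ 2 (μ n)) V ∧
      ∀ n (φ : ℝ →ᵇ ℂ) (g h : Lp ℂ 2 (μ n)), g =ᵐ[μ n] (fun x => φ x * h x) →
        V n g = selfAdjointCalculus C φ (V n h) := by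
  obtain ⟨w, horth, htot⟩ := exists_cyclic_decomposition hC
  choose V hV using fun n => exists_cyclic_isometry hC (w n)
  refine ⟨fun n => spectralMeasure hC (w n), fun n => inferInstance, V,
    fun n => spectralMeasure_compl_spectrum hC _, IsHilbertSum.mk ?_ ?_,
    fun n φ g h => cyclic_isometry_mul hC (hV n) φ⟩
  · intro i j hij g h
    refine (BoundedContinuousFunction.toLp_denseRange ℂ (spectralMeasure hC (w i)) ℂ
      (by norm_num : (2 : ENNReal) ≠ ⊤)).induction_on
      (p := fun g => ⟪V i g, V j h⟫_ℂ = 0) g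
      (isClosed_eq (by fun_prop) (by fun_prop)) fun φ => ?_
    refine (BoundedContinuousFunction.toLp_denseRange ℂ (spectralMeasure hC (w j)) ℂ
      (by norm_num : (2 : ENNReal) ≠ ⊤)).induction_on
      (p := fun h => ⟪V i _, V j h⟫_ℂ = 0) h
      (isClosed_eq (by fun_prop) (by fun_prop)) fun ψ => ?_
    rw [hV, hV]
    exact horth i j hij φ ψ
  · rw [top_le_iff, Submodule.topologicalClosure_eq_top_iff, Submodule.eq_bot_iff]
    intro h hh
    refine htot h fun j φ => ?_
    rw [← hV]
    exact (Submodule.mem_orthogonal _ _).1 hh _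
      (Submodule.mem_iSup_of_mem j ⟨_, rfl⟩)

end Cyclic

/-! ### Operators on `L²(ν; N)` that commute with multiplications are operator fields. -/

section Decomposable

open scoped BoundedContinuousFunction

variable {N : Type*} [NormedAddCommGroup N] [InnerProductSpace ℂ N]
  {ι : Type*} (b : HilbertBasis ι ℂ N)

include b in
theorem HilbertBasis.stronglyMeasurable_of_inner [Countable ι] {f : ℝ → N}
    (h : ∀ i, StronglyMeasurable fun x => ⟪b i, f x⟫_ℂ) : StronglyMeasurable f := by
  -- Countability of `ι` makes this filter on finite sets countably generated, so measurability
  -- survives the limit.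
  refine stronglyMeasurable_of_tendsto (Filter.atTop : Filter (Finset ι))
    (f := fun s x => ∑ i ∈ s, ⟪b i, f x⟫_ℂ • b i) (fun s => ?_) ?_
  · exact Finset.stronglyMeasurable_fun_sum _ fun i _ => (h i).smul_const _
  · rw [tendsto_pi_nhds]
    intro x
    have := b.hasSum_repr (f x)
    simp only [b.repr_apply_apply] at this
    exact this

theorem HilbertBasis.ext_inner {v w : N} (h : ∀ i, ⟪b i, v⟫_ℂ = ⟪b i, w⟫_ℂ) : v = w := by
  refine b.repr.injective (lp.ext (funext fun i => ?_))
  rw [b.repr_apply_apply, b.repr_apply_apply, h]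

/-- The operator with given rows, when these satisfy a Bessel inequality. -/
theorem HilbertBasis.exists_clm_of_rows (r : ι → N) {M : ℝ} (hM : 0 ≤ M)
    (h : ∀ v, ∀ s : Finset ι, ∑ i ∈ s, ‖⟪r i, v⟫_ℂ‖ ^ 2 ≤ (M * ‖v‖) ^ 2) :
    ∃ A : N →L[ℂ] N, ‖A‖ ≤ M ∧ ∀ v i, ⟪b i, A v⟫_ℂ = ⟪r i, v⟫_ℂ := by
  have hmem : ∀ v, Memℓp (fun i => ⟪r i, v⟫_ℂ) 2 := fun v =>
    memℓp_gen' (C := (M * ‖v‖) ^ 2) fun s => by simpa using h v s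
  let f : N →ₗ[ℂ] lp (fun _ : ι => ℂ) 2 :=
    { toFun := fun v => ⟨fun i => ⟪r i, v⟫_ℂ, hmem v⟩
      map_add' := fun v w => by
        ext i; exact inner_add_right _ _ _
      map_smul' := fun c v => by
        ext i; exact inner_smul_right _ _ _ }
  have hf : ∀ v, ‖f v‖ ≤ M * ‖v‖ := fun v =>
    lp.norm_le_of_forall_sum_le (by norm_num) (by positivity) fun s => by
      simpa [f] using h v s
  refine ⟨(b.repr.symm : _ →L[ℂ] N).comp (f.mkContinuous M hf), ?_, fun v i => ?_⟩
  · refine ContinuousLinearMap.opNorm_le_bound _ hM fun v => ?_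
    change ‖b.repr.symm (f v)‖ ≤ _
    rw [LinearIsometryEquiv.norm_map]
    exact hf v
  · change ⟪b i, b.repr.symm (f v)⟫_ℂ = _
    rw [← b.repr_apply_apply, LinearIsometryEquiv.apply_symm_apply]
    rfl

theorem Lp_norm_sq_eq_integral {ν : Measure ℝ} (g : Lp N 2 ν) :
    ‖g‖ ^ 2 = ∫ x, ‖g x‖ ^ 2 ∂ν := by
  have h := inner_self_eq_norm_sq_to_K (𝕜 := ℂ) g
  rw [L2.inner_def] at h
  simp only [inner_self_eq_norm_sq_to_K] at h
  have h2 : ∫ x, ((‖g x‖ : ℂ)) ^ 2 ∂ν = ((∫ x, ‖g x‖ ^ 2 ∂ν : ℝ) : ℂ) := by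
    rw [← integral_complex_ofReal]
    simp
  exact Complex.ofReal_injective (by simpa using (h2.symm.trans h).symm)

variable [CompleteSpace N] {ν : Measure ℝ} {T : Lp N 2 ν →L[ℂ] Lp N 2 ν}

/-- A self-adjoint operator that commutes with the multiplications by continuous functions is
symmetric pointwise. -/
theorem ae_inner_comm_of_commute (hT : IsSelfAdjoint T)
    (hcomm : ∀ (φ : ℝ →ᵇ ℂ) (g h : Lp N 2 ν), h =ᵐ[ν] (fun x => φ x • g x) →
      T h =ᵐ[ν] fun x => φ x • T g x) (g h : Lp N 2 ν) :
    ∀ᵐ x ∂ν, ⟪h x, T g x⟫_ℂ = ⟪T h x, g x⟫_ℂ := by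
  have i1 : Integrable (fun x => ⟪h x, T g x⟫_ℂ) ν := L2.integrable_inner h (T g)
  have i2 : Integrable (fun x => ⟪T h x, g x⟫_ℂ) ν := L2.integrable_inner (T h) g
  -- `⟨h, T(φ g)⟩ = ⟨T h, φ g⟩` says that the two functions have equal integrals against every
  -- smooth compactly supported `φ`.
  have key := ae_eq_zero_of_integral_contDiff_smul_eq_zero (μ := ν) (i1.sub i2).locallyIntegrable
    (fun φ hφ hcs => by
      obtain ⟨c, hc⟩ := hcs.exists_bound_of_continuous hφ.continuous
      let ψ : ℝ →ᵇ ℂ := BoundedContinuousFunction.ofNormedAddCommGroup (fun x => (φ x : ℂ))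
        (Complex.continuous_ofReal.comp hφ.continuous) c (fun x => by simpa using hc x)
      obtain ⟨Mψ, hMψ⟩ := exists_multiplication_boundedContinuous (E := N) ν ψ
      have h1 := hcomm ψ g (Mψ g) (hMψ g)
      have h2 : ⟪h, T (Mψ g)⟫_ℂ = ⟪T h, Mψ g⟫_ℂ :=
        ((ContinuousLinearMap.isSelfAdjoint_iff_isSymmetric.1 hT) h (Mψ g)).symm
      rw [L2.inner_def, L2.inner_def] at h2
      have h3 : ∫ x, φ x • ⟪h x, T g x⟫_ℂ ∂ν = ∫ x, φ x • ⟪T h x, g x⟫_ℂ ∂ν := by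
        convert h2 using 1
        · refine integral_congr_ae ?_
          filter_upwards [h1] with x hx
          rw [hx, inner_smul_right]
          rfl
        · refine integral_congr_ae ?_
          filter_upwards [hMψ g] with x hx
          rw [hx, inner_smul_right]
          rfl
      have j1 : Integrable (fun x => φ x • ⟪h x, T g x⟫_ℂ) ν :=
        i1.bdd_smul c hφ.continuous.aestronglyMeasurable (Filter.Eventually.of_forall hc)
      have j2 : Integrable (fun x => φ x • ⟪T h x, g x⟫_ℂ) ν :=
        i2.bdd_smul c hφ.continuous.aestronglyMeasurable (Filter.Eventually.of_forall hc)
      simp only [Pi.sub_apply, smul_sub]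
      rw [integral_sub j1 j2, h3, sub_self])
  filter_upwards [key] with x hx
  exact sub_eq_zero.1 hx

include b in
/-- A non-negative operator on `L²(ν; N)` that commutes with the multiplications by continuous
functions is the multiplication by a bounded measurable function with values in the non-negative
operators. -/
theorem exists_decomposition [Countable ι] [IsFiniteMeasure ν]
    [TopologicalSpace.SeparableSpace N] (hT : T.IsPositive)
    (hcomm : ∀ (φ : ℝ →ᵇ ℂ) (g h : Lp N 2 ν), h =ᵐ[ν] (fun x => φ x • g x) →
      T h =ᵐ[ν] fun x => φ x • T g x) :
    ∃ n : ℝ → N →L[ℂ] N, (∀ v, StronglyMeasurable fun x => n x v) ∧ (∀ x, (n x).IsPositive) ∧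
      (∀ x, ‖n x‖ ≤ ‖T‖) ∧ ∀ g : Lp N 2 ν, T g =ᵐ[ν] fun x => n x (g x) := by
  have hsym := ae_inner_comm_of_commute hT.isSelfAdjoint hcomm
  -- Constants are in `L²` because `ν` is finite, so `T` applied to them gives the columns of the
  -- field. By pointwise symmetry the columns are also its rows, and the rows determine `T g` for
  -- every `g`.
  let col : ι → ℝ → N := fun i x => T (Lp.const 2 ν (b i)) x
  have hcol : ∀ i, StronglyMeasurable (col i) := fun i => Lp.stronglyMeasurable _
  have hrow : ∀ g : Lp N 2 ν, ∀ᵐ x ∂ν, ∀ i, ⟪b i, T g x⟫_ℂ = ⟪col i x, g x⟫_ℂ := by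
    intro g
    rw [ae_all_iff]
    intro i
    filter_upwards [hsym g (Lp.const 2 ν (b i)), Lp.coeFn_const (p := 2) (μ := ν) (b i)]
      with x h1 h2
    rw [h2] at h1
    exact h1
  -- Commutation was assumed for continuous functions only; the row formula extends it to indicators
  -- of measurable sets. This localizes the norm bound and the positivity of `T` to points.
  have hind : ∀ (c : N) (E : Set ℝ) (hE : MeasurableSet E),
      T (indicatorConstLp 2 hE (measure_ne_top ν E) c) =ᵐ[ν]
        E.indicator (T (Lp.const 2 ν c)) := by
    intro c E hE
    filter_upwards [hrow (indicatorConstLp 2 hE (measure_ne_top ν E) c), hrow (Lp.const 2 ν c),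
      indicatorConstLp_coeFn (p := 2) (hs := hE) (hμs := measure_ne_top ν E) (c := c),
      Lp.coeFn_const (p := 2) (μ := ν) c] with x h1 h2 h3 h4
    refine b.ext_inner fun i => ?_
    rw [h1, h3]
    by_cases hx : x ∈ E
    · rw [Set.indicator_of_mem hx, Set.indicator_of_mem hx, h2, h4]; rfl
    · rw [Set.indicator_of_notMem hx, Set.indicator_of_notMem hx, inner_zero_right,
        inner_zero_right]
  have hbound : ∀ c : N, ∀ᵐ x ∂ν, ‖T (Lp.const 2 ν c) x‖ ^ 2 ≤ (‖T‖ * ‖c‖) ^ 2 := by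
    intro c
    refine ae_le_of_forall_setIntegral_le ((Lp.memLp _).integrable_norm_pow two_ne_zero)
      (integrable_const _) fun E hE _ => ?_
    have h1 : ∫ x in E, ‖T (Lp.const 2 ν c) x‖ ^ 2 ∂ν =
        ‖T (indicatorConstLp 2 hE (measure_ne_top ν E) c)‖ ^ 2 := by
      rw [Lp_norm_sq_eq_integral, ← integral_indicator hE]
      refine integral_congr_ae ?_
      filter_upwards [hind c E hE] with x hx
      rw [hx]
      by_cases h : x ∈ E <;> simp [h]
    have h2 : ‖indicatorConstLp 2 hE (measure_ne_top ν E) c‖ ^ 2 = ‖c‖ ^ 2 * ν.real E := by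
      rw [Lp_norm_sq_eq_integral, mul_comm, ← smul_eq_mul, ← setIntegral_const,
        ← integral_indicator hE]
      refine integral_congr_ae ?_
      filter_upwards [indicatorConstLp_coeFn (p := 2) (hs := hE) (hμs := measure_ne_top ν E)
        (c := c)] with x hx
      rw [hx]
      by_cases h : x ∈ E <;> simp [h]
    rw [h1, setIntegral_const, smul_eq_mul]
    calc ‖T (indicatorConstLp 2 hE (measure_ne_top ν E) c)‖ ^ 2
        ≤ (‖T‖ * ‖indicatorConstLp 2 hE (measure_ne_top ν E) c‖) ^ 2 := by
          gcongr; exact T.le_opNorm _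
      _ = ν.real E * (‖T‖ * ‖c‖) ^ 2 := by rw [mul_pow, h2]; ring
  have hpos : ∀ c : N, ∀ᵐ x ∂ν, 0 ≤ (⟪c, T (Lp.const 2 ν c) x⟫_ℂ).re ∧
      (⟪c, T (Lp.const 2 ν c) x⟫_ℂ).im = 0 := by
    intro c
    have hi : Integrable (fun x => ⟪c, T (Lp.const 2 ν c) x⟫_ℂ) ν :=
      ((Lp.memLp (T (Lp.const 2 ν c))).integrable one_le_two).const_inner c
    have h0 : 0 ≤ᵐ[ν] fun x => (⟪c, T (Lp.const 2 ν c) x⟫_ℂ).re := by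
      refine ae_nonneg_of_forall_setIntegral_nonneg hi.re fun E hE _ => ?_
      have h1 := hT.re_inner_nonneg_right (indicatorConstLp 2 hE (measure_ne_top ν E) c)
      rw [L2.inner_def] at h1
      have h2 : ∫ x, ⟪indicatorConstLp 2 hE (measure_ne_top ν E) c x,
          T (indicatorConstLp 2 hE (measure_ne_top ν E) c) x⟫_ℂ ∂ν =
          ∫ x in E, ⟪c, T (Lp.const 2 ν c) x⟫_ℂ ∂ν := by
        rw [← integral_indicator hE]
        refine integral_congr_ae ?_
        filter_upwards [hind c E hE, indicatorConstLp_coeFn (p := 2) (hs := hE)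
          (hμs := measure_ne_top ν E) (c := c)] with x hx hx'
        rw [hx, hx']
        by_cases h : x ∈ E <;> simp [h]
      rw [h2] at h1
      exact h1.trans_eq (integral_re hi.integrableOn).symm
    filter_upwards [h0, hsym (Lp.const 2 ν c) (Lp.const 2 ν c),
      Lp.coeFn_const (p := 2) (μ := ν) c] with x h1 h2 h3
    refine ⟨h1, ?_⟩
    rw [h3] at h2
    refine Complex.conj_eq_iff_im.1 ?_
    rw [inner_conj_symm]
    exact h2.symm
  let d := TopologicalSpace.denseSeq N
  have hd : DenseRange d := TopologicalSpace.denseRange_denseSeq N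
  -- The rows define an operator of norm at most `‖T‖` once Bessel's inequality holds on a countable
  -- dense set of vectors; countability makes the exceptional set null.
  let S : Set ℝ := {x | ∀ k, ∀ s : Finset ι, ∑ i ∈ s, ‖⟪col i x, d k⟫_ℂ‖ ^ 2 ≤ (‖T‖ * ‖d k‖) ^ 2}
  have hSm : MeasurableSet S := by
    simp only [S, Set.ofPred_forall]
    refine MeasurableSet.iInter fun k => MeasurableSet.iInter fun s => ?_
    refine measurableSet_le (Finset.measurable_fun_sum _ fun i _ => ?_) measurable_const
    exact (((hcol i).inner stronglyMeasurable_const).norm.measurable).pow_const _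
  have hSae : ∀ᵐ x ∂ν, x ∈ S := by
    change ∀ᵐ x ∂ν, ∀ k, ∀ s : Finset ι, ∑ i ∈ s, ‖⟪col i x, d k⟫_ℂ‖ ^ 2 ≤ (‖T‖ * ‖d k‖) ^ 2
    rw [ae_all_iff]
    intro k
    filter_upwards [hrow (Lp.const 2 ν (d k)), hbound (d k),
      Lp.coeFn_const (p := 2) (μ := ν) (d k)] with x h1 h2 h3 s
    refine le_trans ?_ h2
    refine le_trans (le_of_eq ?_) (b.orthonormal.sum_inner_products_le (s := s) _)
    refine Finset.sum_congr rfl fun i _ => ?_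
    rw [h1, h3]; rfl
  have hA : ∀ x ∈ S, ∃ A : N →L[ℂ] N, ‖A‖ ≤ ‖T‖ ∧ ∀ v i, ⟪b i, A v⟫_ℂ = ⟪col i x, v⟫_ℂ := by
    intro x hx
    refine b.exists_clm_of_rows _ (norm_nonneg _) fun v s => ?_
    exact hd.induction_on (p := fun v => ∑ i ∈ s, ‖⟪col i x, v⟫_ℂ‖ ^ 2 ≤ (‖T‖ * ‖v‖) ^ 2) v
      (isClosed_le (by fun_prop) (by fun_prop)) fun k => hx k s
  choose! A hA1 hA2 using hA
  -- Outside `S` the family `A` is an arbitrary choice, so it is cut off before measurability is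
  -- claimed.
  have hAm : ∀ v, StronglyMeasurable fun x => S.indicator (fun x => A x v) x := by
    intro v
    refine b.stronglyMeasurable_of_inner fun i => ?_
    have : (fun x => ⟪b i, S.indicator (fun x => A x v) x⟫_ℂ) =
        S.indicator fun x => ⟪col i x, v⟫_ℂ := by
      funext x
      by_cases hx : x ∈ S
      · simp only [Set.indicator_of_mem hx, hA2 x hx]
      · simp only [Set.indicator_of_notMem hx, inner_zero_right]
    rw [this]
    exact ((hcol i).inner stronglyMeasurable_const).indicator hSm
  have hTA : ∀ g : Lp N 2 ν, ∀ᵐ x ∂ν, x ∈ S ∧ T g x = A x (g x) := by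
    intro g
    filter_upwards [hSae, hrow g] with x hx h1
    exact ⟨hx, b.ext_inner fun i => by rw [h1, hA2 x hx]⟩
  let S' : Set ℝ := {x | ∀ k, 0 ≤ (⟪d k, S.indicator (fun x => A x (d k)) x⟫_ℂ).re ∧
    (⟪d k, S.indicator (fun x => A x (d k)) x⟫_ℂ).im = 0}
  have hSm' : MeasurableSet S' := by
    simp only [S', Set.ofPred_forall]
    refine MeasurableSet.iInter fun k => ?_
    have hm : Measurable fun x => ⟪d k, S.indicator (fun x => A x (d k)) x⟫_ℂ :=
      (stronglyMeasurable_const.inner (hAm (d k))).measurable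
    exact (measurableSet_le measurable_const (Complex.measurable_re.comp hm)).inter
      (measurableSet_eq_fun (Complex.measurable_im.comp hm) measurable_const)
  have hSae' : ∀ᵐ x ∂ν, x ∈ S' := by
    change ∀ᵐ x ∂ν, ∀ k, _
    rw [ae_all_iff]
    intro k
    filter_upwards [hTA (Lp.const 2 ν (d k)), hpos (d k),
      Lp.coeFn_const (p := 2) (μ := ν) (d k)] with x h1 h2 h3
    rw [Set.indicator_of_mem h1.1]
    rw [h1.2, h3] at h2
    exact h2
  -- The value `0` on the exceptional null set makes positivity and the norm bound hold at every
  -- point.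
  refine ⟨(S ∩ S').indicator A, fun v => ?_, fun x => ?_, fun x => ?_, fun g => ?_⟩
  · have : (fun x => (S ∩ S').indicator A x v) =
        S'.indicator fun x => S.indicator (fun x => A x v) x := by
      funext x
      by_cases h1 : x ∈ S <;> by_cases h2 : x ∈ S' <;> simp [h1, h2]
    rw [this]
    exact (hAm v).indicator hSm'
  · by_cases hx : x ∈ S ∩ S'
    · rw [Set.indicator_of_mem hx, ContinuousLinearMap.isPositive_iff_complex]
      have h1 : ∀ v, 0 ≤ (⟪v, A x v⟫_ℂ).re ∧ (⟪v, A x v⟫_ℂ).im = 0 := by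
        intro v
        refine hd.induction_on
          (p := fun v => 0 ≤ (⟪v, A x v⟫_ℂ).re ∧ (⟪v, A x v⟫_ℂ).im = 0) v ?_ fun k => ?_
        · have hcont : Continuous fun v => ⟪v, A x v⟫_ℂ := by fun_prop
          exact (isClosed_le continuous_const (Complex.continuous_re.comp hcont)).inter
            (isClosed_eq (Complex.continuous_im.comp hcont) continuous_const)
        · have := hx.2 k
          rw [Set.indicator_of_mem hx.1] at this
          exact this
      intro v
      rw [← inner_conj_symm, Complex.conj_eq_iff_im.2 (h1 v).2]
      refine ⟨?_, (h1 v).1⟩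
      exact Complex.ext (by simp) (by simp [(h1 v).2])
    · rw [Set.indicator_of_notMem hx]
      exact ContinuousLinearMap.isPositive_zero
  · by_cases hx : x ∈ S ∩ S'
    · rw [Set.indicator_of_mem hx]
      exact hA1 x hx.1
    · rw [Set.indicator_of_notMem hx, norm_zero]
      exact norm_nonneg _
  · filter_upwards [hTA g, hSae'] with x h1 h2
    rw [Set.indicator_of_mem (show x ∈ S ∩ S' from ⟨h1.1, h2⟩), h1.2]

end Decomposable

/-! ### Operator measures that are diagonal in an orthonormal basis. -/

theorem HasSum.congr_of_forall {ι : Type*} {f g : ι → ℂ} {s : ℂ} (hf : HasSum f s)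
    (h : ∀ i, f i = g i) : HasSum g s :=
  funext h ▸ hf

theorem integrable_of_hasSum {ι : Type*} [Countable ι] {μ : Measure ℝ} {f : ι → ℝ → ℂ} {g : ℝ → ℂ}
    (hg : AEStronglyMeasurable g μ) (hf : ∀ i, Integrable (f i) μ)
    (hs : Summable fun i => ∫ x, ‖f i x‖ ∂μ) (h : ∀ x, HasSum (fun i => f i x) (g x)) :
    Integrable g μ := by
  refine ⟨hg, ?_⟩
  have h1 : ∀ x, ‖g x‖ₑ ≤ ∑' i, ‖f i x‖ₑ := fun x => by
    rw [← (h x).tsum_eq]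
    exact enorm_tsum_le_tsum_enorm
  have h2 : ∀ i, ∫⁻ x, ‖f i x‖ₑ ∂μ = ENNReal.ofReal (∫ x, ‖f i x‖ ∂μ) := fun i =>
    (ofReal_integral_norm_eq_lintegral_enorm (hf i)).symm
  calc ∫⁻ x, ‖g x‖ₑ ∂μ ≤ ∫⁻ x, ∑' i, ‖f i x‖ₑ ∂μ := lintegral_mono h1
    _ = ∑' i, ∫⁻ x, ‖f i x‖ₑ ∂μ := lintegral_tsum fun i => (hf i).1.enorm
    _ = ∑' i, ENNReal.ofReal (∫ x, ‖f i x‖ ∂μ) := by simp only [h2]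
    _ = ENNReal.ofReal (∑' i, ∫ x, ‖f i x‖ ∂μ) :=
      (ENNReal.ofReal_tsum_of_nonneg (fun i => integral_nonneg fun x => norm_nonneg _) hs).symm
    _ < ⊤ := ENNReal.ofReal_lt_top

section Diagonal

variable {N : Type*} [NormedAddCommGroup N] [InnerProductSpace ℂ N]
  {ι : Type*} (b : HilbertBasis ι ℂ N)

theorem HilbertBasis.exists_diag {a : ι → ℝ} {M : ℝ} (hM : ∀ i, |a i| ≤ M) :
    -- The absolute value matters when `ι` is empty, since `M` may then be negative.
    ∃ A : N →L[ℂ] N, ‖A‖ ≤ |M| ∧ ∀ v i, ⟪b i, A v⟫_ℂ = a i * ⟪b i, v⟫_ℂ := by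
  have hM' : ∀ i, |a i| ≤ |M| := fun i => (hM i).trans (le_abs_self M)
  obtain ⟨A, hA0, hA⟩ := b.exists_clm_of_rows (fun i => (a i : ℂ) • b i) (abs_nonneg M) (by
    intro v s
    calc ∑ i ∈ s, ‖⟪(a i : ℂ) • b i, v⟫_ℂ‖ ^ 2
        ≤ ∑ i ∈ s, |M| ^ 2 * ‖⟪b i, v⟫_ℂ‖ ^ 2 := by
          refine Finset.sum_le_sum fun i _ => ?_
          rw [inner_smul_left, norm_mul, mul_pow]
          gcongr
          simpa using hM' i
      _ = |M| ^ 2 * ∑ i ∈ s, ‖⟪b i, v⟫_ℂ‖ ^ 2 := by rw [Finset.mul_sum]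
      _ ≤ |M| ^ 2 * ‖v‖ ^ 2 := by
          gcongr
          exact b.orthonormal.sum_inner_products_le v
      _ = (|M| * ‖v‖) ^ 2 := by ring)
  exact ⟨A, hA0, fun v i => by rw [hA, inner_smul_left, Complex.conj_ofReal]⟩

open Classical in
/-- The operator with the given eigenvalues on an orthonormal basis. -/
def HilbertBasis.diag (a : ι → ℝ) : N →L[ℂ] N :=
  if h : ∃ M, ∀ i, |a i| ≤ M then (b.exists_diag h.choose_spec).choose else 0

variable {a : ι → ℝ}

theorem HilbertBasis.inner_diag (ha : ∃ M, ∀ i, |a i| ≤ M) (v : N) (i : ι) :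
    ⟪b i, b.diag a v⟫_ℂ = a i * ⟪b i, v⟫_ℂ := by
  rw [HilbertBasis.diag, dif_pos ha]
  exact (b.exists_diag ha.choose_spec).choose_spec.2 v i

theorem HilbertBasis.norm_diag_le {M : ℝ} (h0 : 0 ≤ M) (hM : ∀ i, |a i| ≤ M) :
    ‖b.diag a‖ ≤ M := by
  obtain ⟨A, hA0, hA⟩ := b.exists_diag hM
  rw [abs_of_nonneg h0] at hA0
  have : b.diag a = A := ContinuousLinearMap.ext fun v => b.ext_inner fun i => by
    rw [b.inner_diag ⟨M, hM⟩, hA]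
  rwa [this]

theorem HilbertBasis.hasSum_diag (ha : ∃ M, ∀ i, |a i| ≤ M) (v w : N) :
    HasSum (fun i => a i * (⟪v, b i⟫_ℂ * ⟪b i, w⟫_ℂ)) ⟪v, b.diag a w⟫_ℂ := by
  have := b.hasSum_inner_mul_inner v (b.diag a w)
  refine HasSum.congr_of_forall this fun i => ?_
  rw [b.inner_diag ha]
  ring

theorem HilbertBasis.inner_diag_left (ha : ∃ M, ∀ i, |a i| ≤ M) (v w : N) :
    ⟪b.diag a v, w⟫_ℂ = ⟪v, b.diag a w⟫_ℂ := by
  refine HasSum.unique (f := fun i => (a i : ℂ) * (⟪v, b i⟫_ℂ * ⟪b i, w⟫_ℂ)) ?_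
    (b.hasSum_diag ha v w)
  refine HasSum.congr_of_forall (b.hasSum_inner_mul_inner (b.diag a v) w) fun i => ?_
  rw [← inner_conj_symm (b.diag a v), b.inner_diag ha, map_mul, inner_conj_symm,
    Complex.conj_ofReal, mul_assoc]

theorem HilbertBasis.diag_isPositive (ha : ∃ M, ∀ i, |a i| ≤ M) (h0 : ∀ i, 0 ≤ a i) :
    (b.diag a).IsPositive := by
  rw [ContinuousLinearMap.isPositive_iff_complex]
  intro v
  have h1 : HasSum (fun i => ((a i * ‖⟪b i, v⟫_ℂ‖ ^ 2 : ℝ) : ℂ)) ⟪b.diag a v, v⟫_ℂ := by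
    rw [b.inner_diag_left ha]
    refine HasSum.congr_of_forall (b.hasSum_diag ha v v) fun i => ?_
    rw [← inner_conj_symm v, ← Complex.normSq_eq_conj_mul_self, Complex.normSq_eq_norm_sq]
    push_cast
    ring
  obtain ⟨r, hr⟩ : ∃ r : ℝ, HasSum (fun i => a i * ‖⟪b i, v⟫_ℂ‖ ^ 2) r :=
    (Complex.summable_ofReal.1 h1.summable)
  have h2 : ⟪b.diag a v, v⟫_ℂ = r := h1.unique (Complex.hasSum_ofReal.2 hr)
  rw [h2]
  refine ⟨by simp, ?_⟩
  simpa using hr.nonneg fun i => mul_nonneg (h0 i) (sq_nonneg _)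

theorem HilbertBasis.diag_congr_of_forall {T : N →L[ℂ] N} (ha : ∃ M, ∀ i, |a i| ≤ M)
    (h : ∀ i, T (b i) = (a i : ℂ) • b i) : b.diag a = T := by
  have h1 : ∀ i, b.diag a (b i) = T (b i) := fun i => b.ext_inner fun j => by
    rw [b.inner_diag ha, h, inner_smul_right]
    by_cases hij : j = i
    · rw [hij]
    · rw [b.orthonormal.2 hij, mul_zero, mul_zero]
  refine ContinuousLinearMap.ext_on (s := Set.range b) ?_ ?_
  · have := b.dense_span
    rw [← Submodule.dense_iff_topologicalClosure_eq_top] at this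
    exact this
  · rintro _ ⟨i, rfl⟩
    exact h1 i

theorem HilbertBasis.stronglyMeasurable_diag [Countable ι] {a : ι → ℝ → ℝ}
    (ha : ∀ i, Measurable (a i)) (hb : ∀ x, ∃ M, ∀ i, |a i x| ≤ M) (v : N) :
    StronglyMeasurable fun x => b.diag (fun i => a i x) v := by
  refine b.stronglyMeasurable_of_inner fun i => ?_
  simp only [fun x => b.inner_diag (hb x) v i]
  exact ((Complex.measurable_ofReal.comp (ha i)).stronglyMeasurable).mul_const _

end Diagonal

/-- Densities, with respect to a finite measure on the line, of a family of scalar measures of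
total mass at most `1`. -/
structure IsDiagonalDensity {ι : Type*} (ν : Measure ℝ) (a : ι → ℝ → ℝ) : Prop where
  measurable : ∀ i, Measurable (a i)
  nonneg : ∀ i x, 0 ≤ a i x
  bounded : ∀ x, ∃ M, ∀ i, |a i x| ≤ M
  integrable : ∀ i, Integrable (a i) ν
  integral_le : ∀ i, ∫ x, a i x ∂ν ≤ 1

namespace IsDiagonalDensity

variable {ι : Type*} {ν : Measure ℝ} {a : ι → ℝ → ℝ}

theorem setIntegral_le (h : IsDiagonalDensity ν a) (s : Set ℝ) (i : ι) :
    |∫ x in s, a i x ∂ν| ≤ 1 := by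
  rw [abs_of_nonneg (integral_nonneg (h.nonneg i))]
  exact (setIntegral_le_integral (h.integrable i)
    (Filter.Eventually.of_forall (h.nonneg i))).trans (h.integral_le i)

theorem bounded_sqrt (h : IsDiagonalDensity ν a) (x : ℝ) : ∃ M, ∀ i, |√(a i x)| ≤ M := by
  obtain ⟨M, hM⟩ := h.bounded x
  refine ⟨√M, fun i => ?_⟩
  rw [abs_of_nonneg (Real.sqrt_nonneg _)]
  exact Real.sqrt_le_sqrt ((le_abs_self _).trans (hM i))

variable {N : Type*} [NormedAddCommGroup N] [InnerProductSpace ℂ N] (b : HilbertBasis ι ℂ N)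
  [Countable ι]

/-- Termwise integration of the eigenvector expansion. Every scalar mass is at most `1`, so the
series of integrals is dominated by the Parseval series, although the densities need not be bounded
uniformly in `x`. -/
theorem integrable_and_hasSum (h : IsDiagonalDensity ν a) (v w : N) (s : Set ℝ) :
    Integrable (fun x => ⟪v, b.diag (fun i => a i x) w⟫_ℂ) (ν.restrict s) ∧
      HasSum (fun i => ((∫ x in s, a i x ∂ν : ℝ) : ℂ) * (⟪v, b i⟫_ℂ * ⟪b i, w⟫_ℂ))
        (∫ x in s, ⟪v, b.diag (fun i => a i x) w⟫_ℂ ∂ν) := by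
  have hi : ∀ i, Integrable (fun x => (a i x : ℂ) * (⟪v, b i⟫_ℂ * ⟪b i, w⟫_ℂ)) (ν.restrict s) :=
    fun i => ((h.integrable i).restrict.ofReal (𝕜 := ℂ)).mul_const _
  have hn : ∀ i, ∫ x in s, ‖(a i x : ℂ) * (⟪v, b i⟫_ℂ * ⟪b i, w⟫_ℂ)‖ ∂ν =
      (∫ x in s, a i x ∂ν) * ‖⟪v, b i⟫_ℂ * ⟪b i, w⟫_ℂ‖ := fun i => by
    rw [← integral_mul_const]
    refine integral_congr_ae (Filter.Eventually.of_forall fun x => ?_)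
    simp only
    rw [norm_mul, Complex.norm_real, Real.norm_of_nonneg (h.nonneg i x)]
  have hs : Summable fun i => ∫ x in s, ‖(a i x : ℂ) * (⟪v, b i⟫_ℂ * ⟪b i, w⟫_ℂ)‖ ∂ν := by
    simp only [hn]
    refine Summable.of_nonneg_of_le (fun i => mul_nonneg (integral_nonneg (h.nonneg i))
      (norm_nonneg _)) (fun i => ?_) (b.summable_inner_mul_inner v w).norm
    exact mul_le_of_le_one_left (norm_nonneg _) ((le_abs_self _).trans (h.setIntegral_le s i))
  have hsum := fun x => b.hasSum_diag (h.bounded x) v w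
  refine ⟨integrable_of_hasSum ?_ hi hs hsum, ?_⟩
  · exact (stronglyMeasurable_const.inner
      (b.stronglyMeasurable_diag h.measurable h.bounded w)).aestronglyMeasurable
  · have := hasSum_integral_of_summable_integral_norm hi hs
    simp only [fun x => (hsum x).tsum_eq, integral_mul_const] at this
    refine HasSum.congr_of_forall this fun i => ?_
    congr 1
    exact integral_complex_ofReal

/-- The operator measure that is diagonal in a fixed basis, with given scalar measures. -/
def operatorMeasure (h : IsDiagonalDensity ν a) [IsFiniteMeasure ν] (h0 : ν {0} = 0) :
    OperatorMeasure N where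
  dist t := b.diag fun i =>
    if 0 ≤ t then ∫ x in Set.Ioc 0 t, a i x ∂ν else -∫ x in Set.Ico t 0, a i x ∂ν
  base := ν
  density x := b.diag fun i => a i x
  base_finite := inferInstance
  base_zero := h0
  density_nonneg x := b.diag_isPositive (h.bounded x) fun i => h.nonneg i x
  density_measurable v := b.stronglyMeasurable_diag h.measurable h.bounded v
  density_integrable v w := by
    simpa using (h.integrable_and_hasSum b v w Set.univ).1
  dist_of_nonneg t ht v w := by
    simp only [if_pos ht]
    exact (b.hasSum_diag ⟨1, h.setIntegral_le _⟩ v w).unique (h.integrable_and_hasSum b v w _).2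
  dist_of_neg t ht v w := by
    simp only [if_neg ht.not_ge]
    refine (b.hasSum_diag ⟨1, fun i => (abs_neg _).trans_le (h.setIntegral_le _ i)⟩ v w).unique ?_
    refine HasSum.congr_of_forall (h.integrable_and_hasSum b v w (Set.Ico t 0)).2.neg fun i => ?_
    push_cast
    ring

variable (h : IsDiagonalDensity ν a) [IsFiniteMeasure ν] (h0 : ν {0} = 0)

theorem inner_dist_of_ne {i j : ι} (hij : i ≠ j) (t : ℝ) :
    ⟪b i, (h.operatorMeasure b h0).dist t (b j)⟫_ℂ = 0 := by
  change ⟪b i, b.diag _ (b j)⟫_ℂ = 0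
  rw [b.inner_diag ⟨1, fun i => ?_⟩, b.orthonormal.2 hij, mul_zero]
  split_ifs
  · exact h.setIntegral_le _ i
  · exact (abs_neg _).trans_le (h.setIntegral_le _ i)

theorem dist_eq_one {t : ℝ} (ht : 0 ≤ t) (h1 : ∀ i, ∫ x in Set.Ioc 0 t, a i x ∂ν = 1) :
    (h.operatorMeasure b h0).dist t = 1 := by
  refine b.diag_congr_of_forall ⟨1, fun i => ?_⟩ fun i => ?_
  · simp [ht, h1]
  · simp [ht, h1]

/-- The square root of the density. -/
def root (a : ι → ℝ → ℝ) (x : ℝ) : N →L[ℂ] N := b.diag fun i => √(a i x)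

include h in
omit [Countable ι] [IsFiniteMeasure ν] in
theorem inner_root (x : ℝ) (v : N) (i : ι) :
    ⟪b i, root b a x v⟫_ℂ = (√(a i x) : ℝ) * ⟪b i, v⟫_ℂ :=
  b.inner_diag (h.bounded_sqrt x) v i

include h in
omit [Countable ι] [IsFiniteMeasure ν] in
theorem inner_root_root (x : ℝ) (v w : N) :
    ⟪root b a x v, root b a x w⟫_ℂ = ⟪v, b.diag (fun i => a i x) w⟫_ℂ := by
  rw [root, b.inner_diag_left (h.bounded_sqrt x)]
  congr 1
  refine b.ext_inner fun i => ?_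
  rw [b.inner_diag (h.bounded_sqrt x), b.inner_diag (h.bounded_sqrt x), b.inner_diag (h.bounded x),
    ← mul_assoc, ← Complex.ofReal_mul, Real.mul_self_sqrt (h.nonneg i x)]

include h in
omit [IsFiniteMeasure ν] in
theorem stronglyMeasurable_root (v : N) : StronglyMeasurable fun x => root b a x v :=
  b.stronglyMeasurable_diag (fun i => (h.measurable i).sqrt) h.bounded_sqrt v

theorem sqIntegrable_iff (f : ℝ → N) (hf : AEStronglyMeasurable f ν) :
    (h.operatorMeasure b h0).SqIntegrable f ↔ MemLp (fun x => root b a x (f x)) 2 ν := by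
  have hm := AEStronglyMeasurable.clm_apply_of_forall (h.stronglyMeasurable_root b) hf
  rw [memLp_two_iff_integrable_sq_norm hm]
  have e : ∀ x, ⟪f x, (h.operatorMeasure b h0).density x (f x)⟫_ℂ =
      ((‖root b a x (f x)‖ ^ 2 : ℝ) : ℂ) := fun x => by
    change ⟪f x, b.diag _ (f x)⟫_ℂ = _
    rw [← h.inner_root_root, inner_self_eq_norm_sq_to_K]
    simp
  unfold OperatorMeasure.SqIntegrable
  simp only [e]
  constructor
  · rintro ⟨-, h2⟩
    refine (h2.re).congr (Filter.Eventually.of_forall fun x => ?_)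
    exact Complex.ofReal_re _
  · exact fun h2 => ⟨hf, h2.ofReal⟩

/-- `∫ ⟨A f, f⟩ = ∫ ‖A^(1/2) f‖²` embeds `L²(N, dF)` in an ordinary Bochner space. No surjectivity
is claimed, because the density may have a kernel. -/
theorem exists_root_isometry [CompleteSpace N] :
    ∃ X : (h.operatorMeasure b h0).L2 →ₗᵢ[ℂ] Lp N 2 ν, ∀ f hf,
      X ((h.operatorMeasure b h0).toL2 f hf) =ᵐ[ν] fun x => root b a x (f x) := by
  have hmem : ∀ f, (h.operatorMeasure b h0).SqIntegrable f →
      MemLp (fun x => root b a x (f x)) 2 ν := fun f hf => (h.sqIntegrable_iff b h0 f hf.1).1 hf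
  obtain ⟨X, hX⟩ := (h.operatorMeasure b h0).exists_linearIsometry
    (fun f hf => (hmem f hf).toLp _)
    (fun f g hf hg => by
      rw [← MemLp.toLp_add, MemLp.toLp_eq_toLp_iff]
      exact Filter.Eventually.of_forall fun x => map_add _ _ _)
    (fun c f hf => by
      rw [← MemLp.toLp_const_smul, MemLp.toLp_eq_toLp_iff]
      exact Filter.Eventually.of_forall fun x => map_smul _ _ _)
    (fun f hf => by
      rw [L2.inner_def]
      refine integral_congr_ae ?_
      filter_upwards [(hmem f hf).coeFn_toLp] with x hx
      rw [hx, h.inner_root_root]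
      rfl)
  refine ⟨X, fun f hf => ?_⟩
  rw [hX]
  exact (hmem f hf).coeFn_toLp

/-- A bounded operator function that commutes with the density preserves square integrability. -/
theorem sqIntegrable_apply {R : ℝ → N →L[ℂ] N} (hR : ∀ v, StronglyMeasurable fun x => R x v)
    {c : ℝ} (hc : ∀ x, ‖R x‖ ≤ c)
    (hcomm : ∀ᵐ x ∂ν, ∀ v, root b a x (R x v) = R x (root b a x v)) {f : ℝ → N}
    (hf : (h.operatorMeasure b h0).SqIntegrable f) :
    (h.operatorMeasure b h0).SqIntegrable fun x => R x (f x) := by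
  have hm := AEStronglyMeasurable.clm_apply_of_forall hR hf.1
  rw [h.sqIntegrable_iff b h0 _ hm]
  refine ((h.sqIntegrable_iff b h0 f hf.1).1 hf).of_le_mul (c := c)
    (AEStronglyMeasurable.clm_apply_of_forall (h.stronglyMeasurable_root b) hm) ?_
  filter_upwards [hcomm] with x hx
  rw [hx]
  exact (R x).le_of_opNorm_le (hc x) _

end IsDiagonalDensity

/-! ### The multiplicity function, its fibres, and the normalised density. -/

section Multiplicity

/-- The number of indices `k < n` for which `ρ k x` is positive. -/
def positiveRank (ρ : ℕ → ℝ → ℝ) (n : ℕ) (x : ℝ) : ℕ :=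
  ∑ k ∈ Finset.range n, {y | 0 < ρ k y}.indicator 1 x

/-- The number of indices `k` for which `ρ k x` is positive. -/
def spectralMultiplicity (ρ : ℕ → ℝ → ℝ) (x : ℝ) : ℕ∞ := ⨆ n, (positiveRank ρ n x : ℕ∞)

variable {ρ : ℕ → ℝ → ℝ}

theorem positiveRank_succ (n : ℕ) (x : ℝ) :
    positiveRank ρ (n + 1) x = positiveRank ρ n x + {y | 0 < ρ n y}.indicator 1 x :=
  Finset.sum_range_succ _ _

theorem positiveRank_succ_of_pos {n : ℕ} {x : ℝ} (h : 0 < ρ n x) :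
    positiveRank ρ (n + 1) x = positiveRank ρ n x + 1 := by
  rw [positiveRank_succ, Set.indicator_of_mem (show x ∈ {y | 0 < ρ n y} from h), Pi.one_apply]

theorem positiveRank_mono (x : ℝ) : Monotone fun n => positiveRank ρ n x :=
  monotone_nat_of_le_succ fun n => by
    rw [positiveRank_succ]; exact Nat.le_add_right _ _

/-- Together with `exists_of_lt_spectralMultiplicity` and `positiveRank_injective`: at a fixed `x`
the rank is a bijection from the indices of positive density onto the positions below the
multiplicity. -/
theorem positiveRank_lt_spectralMultiplicity {n : ℕ} {x : ℝ} (h : 0 < ρ n x) :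
    (positiveRank ρ n x : ℕ∞) < spectralMultiplicity ρ x := by
  refine lt_iSup_iff.2 ⟨n + 1, ?_⟩
  rw [positiveRank_succ_of_pos h]
  exact_mod_cast Nat.lt_succ_self _

theorem exists_of_lt_positiveRank {r n : ℕ} {x : ℝ} (h : r < positiveRank ρ n x) :
    ∃ k, 0 < ρ k x ∧ positiveRank ρ k x = r := by
  induction n with
  | zero => simp [positiveRank] at h
  | succ n ih =>
    by_cases hr : r < positiveRank ρ n x
    · exact ih hr
    · by_cases hn : 0 < ρ n x
      · refine ⟨n, hn, ?_⟩
        rw [positiveRank_succ_of_pos hn] at h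
        omega
      · rw [positiveRank_succ, Set.indicator_of_notMem (show x ∉ {y | 0 < ρ n y} from hn)] at h
        exact absurd h hr

theorem exists_of_lt_spectralMultiplicity {r : ℕ} {x : ℝ} (h : (r : ℕ∞) < spectralMultiplicity ρ x) :
    ∃ k, 0 < ρ k x ∧ positiveRank ρ k x = r := by
  obtain ⟨n, hn⟩ := lt_iSup_iff.1 h
  exact exists_of_lt_positiveRank (by exact_mod_cast hn)

theorem positiveRank_injective {m n : ℕ} {x : ℝ} (hm : 0 < ρ m x) (hn : 0 < ρ n x)
    (h : positiveRank ρ m x = positiveRank ρ n x) : m = n := by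
  rcases lt_trichotomy m n with hlt | rfl | hlt
  · have := positiveRank_mono (ρ := ρ) x (Nat.succ_le_of_lt hlt)
    simp only [Nat.succ_eq_add_one, positiveRank_succ_of_pos hm] at this
    omega
  · rfl
  · have := positiveRank_mono (ρ := ρ) x (Nat.succ_le_of_lt hlt)
    simp only [Nat.succ_eq_add_one, positiveRank_succ_of_pos hn] at this
    omega

theorem measurable_positiveRank (hρ : ∀ n, Measurable (ρ n)) (n : ℕ) :
    Measurable (positiveRank ρ n) :=
  Finset.measurable_fun_sum _ fun k _ =>
    measurable_one.indicator (measurableSet_lt measurable_const (hρ k))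

/-- The sublevel sets are countable intersections. As `ℕ∞` is countable, each fibre, including that
of `⊤`, is a sublevel set minus countably many smaller ones. -/
theorem measurable_spectralMultiplicity (hρ : ∀ n, Measurable (ρ n)) : Measurable (spectralMultiplicity ρ) := by
  have hle : ∀ k : ℕ∞, MeasurableSet {x | spectralMultiplicity ρ x ≤ k} := fun k => by
    have : {x | spectralMultiplicity ρ x ≤ k} =
        ⋂ n, positiveRank ρ n ⁻¹' {r | (r : ℕ∞) ≤ k} := by
      ext x
      simp [spectralMultiplicity]
    rw [this]
    exact MeasurableSet.iInter fun n => measurable_positiveRank hρ n (by trivial)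
  refine measurable_to_countable' fun k => ?_
  have : spectralMultiplicity ρ ⁻¹' {k} = {x | spectralMultiplicity ρ x ≤ k} \
      ⋃ j : Set.Iio k, {x | spectralMultiplicity ρ x ≤ j} := by
    ext x
    simp only [Set.mem_preimage, Set.mem_singleton_iff, Set.mem_sdiff, Set.mem_ofPred_eq,
      Set.mem_iUnion, not_exists]
    constructor
    · rintro rfl
      exact ⟨le_rfl, fun j => j.2.not_ge⟩
    · rintro ⟨h1, h2⟩
      by_contra h3
      exact h2 ⟨_, lt_of_le_of_ne h1 h3⟩ le_rfl
  rw [this]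
  exact (hle k).diff (MeasurableSet.iUnion fun j => hle j)

/-- The pairs of a multiplicity that occurs and a position smaller than it. -/
abbrev MultiplicityIndex (ν : Measure ℝ) (ρ : ℕ → ℝ → ℝ) : Type :=
  {i : ℕ∞ × ℕ // (i.2 : ℕ∞) < i.1 ∧ ν (spectralMultiplicity ρ ⁻¹' {i.1}) ≠ 0}

variable (ν : Measure ℝ)

/-- The reciprocal of the measure of the set where the multiplicity is the same as at `x`. -/
def multiplicityWeight (ρ : ℕ → ℝ → ℝ) (x : ℝ) : ℝ :=
  (ν.real (spectralMultiplicity ρ ⁻¹' {spectralMultiplicity ρ x}))⁻¹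

/-- The normalised restrictions of the measure to the sets of constant multiplicity. -/
def multiplicityDensity (ρ : ℕ → ℝ → ℝ) (i : MultiplicityIndex ν ρ) (x : ℝ) : ℝ :=
  (spectralMultiplicity ρ ⁻¹' {i.1.1}).indicator (fun _ => (ν.real (spectralMultiplicity ρ ⁻¹' {i.1.1}))⁻¹) x

theorem multiplicityDensity_of_eq {i : MultiplicityIndex ν ρ} {x : ℝ}
    (h : spectralMultiplicity ρ x = i.1.1) : multiplicityDensity ν ρ i x = multiplicityWeight ν ρ x := by
  rw [multiplicityDensity, Set.indicator_of_mem (by exact h), multiplicityWeight, h]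

theorem multiplicityDensity_of_ne {i : MultiplicityIndex ν ρ} {x : ℝ}
    (h : spectralMultiplicity ρ x ≠ i.1.1) : multiplicityDensity ν ρ i x = 0 :=
  Set.indicator_of_notMem (s := spectralMultiplicity ρ ⁻¹' {i.1.1}) h _

theorem multiplicityWeight_nonneg (x : ℝ) : 0 ≤ multiplicityWeight ν ρ x :=
  inv_nonneg.2 measureReal_nonneg

theorem measurable_multiplicityWeight (hρ : ∀ n, Measurable (ρ n)) :
    Measurable (multiplicityWeight ν ρ) :=
  (measurable_from_top (f := fun k : ℕ∞ => (ν.real (spectralMultiplicity ρ ⁻¹' {k}))⁻¹)).comp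
    (measurable_spectralMultiplicity hρ)

/-- There are only countably many multiplicities, so all null level sets can be discarded at once.
-/
theorem ae_multiplicity_ne_zero :
    ∀ᵐ x ∂ν, ν (spectralMultiplicity ρ ⁻¹' {spectralMultiplicity ρ x}) ≠ 0 := by
  have h1 : ∀ᵐ x ∂ν, ∀ k : ℕ∞, ν (spectralMultiplicity ρ ⁻¹' {k}) = 0 → spectralMultiplicity ρ x ≠ k := by
    rw [ae_all_iff]
    intro k
    by_cases h : ν (spectralMultiplicity ρ ⁻¹' {k}) = 0
    · filter_upwards [compl_mem_ae_iff.2 h] with x hx _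
      exact hx
    · exact Filter.Eventually.of_forall fun x h' => absurd h' h
  filter_upwards [h1] with x hx h
  exact hx _ h rfl

variable [IsFiniteMeasure ν]

theorem measureReal_multiplicity_pos (i : MultiplicityIndex ν ρ) :
    0 < ν.real (spectralMultiplicity ρ ⁻¹' {i.1.1}) :=
  ENNReal.toReal_pos i.2.2 (measure_ne_top _ _)

/-- The normalisation behind `F(t) = I`. -/
theorem setIntegral_multiplicityDensity (hρ : ∀ n, Measurable (ρ n)) (i : MultiplicityIndex ν ρ)
    (s : Set ℝ) (hs : ν sᶜ = 0) : ∫ x in s, multiplicityDensity ν ρ i x ∂ν = 1 := by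
  have hm : MeasurableSet (spectralMultiplicity ρ ⁻¹' {i.1.1}) :=
    measurable_spectralMultiplicity hρ (measurableSet_singleton _)
  rw [Measure.restrict_eq_self_of_ae_mem (by exact mem_ae_iff.2 hs)]
  change ∫ x, (spectralMultiplicity ρ ⁻¹' {i.1.1}).indicator _ x ∂ν = 1
  rw [integral_indicator hm, setIntegral_const, smul_eq_mul,
    mul_inv_cancel₀ (measureReal_multiplicity_pos ν i).ne']

theorem isDiagonalDensity_multiplicity (hρ : ∀ n, Measurable (ρ n)) :
    IsDiagonalDensity ν (multiplicityDensity ν ρ) where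
  measurable i := measurable_const.indicator
    (measurable_spectralMultiplicity hρ (measurableSet_singleton _))
  nonneg i x := Set.indicator_nonneg (fun _ _ => inv_nonneg.2 measureReal_nonneg) x
  bounded x := ⟨multiplicityWeight ν ρ x, fun i => by
    by_cases h : spectralMultiplicity ρ x = i.1.1
    · rw [multiplicityDensity_of_eq ν h, abs_of_nonneg (multiplicityWeight_nonneg ν x)]
    · rw [multiplicityDensity_of_ne ν h, abs_zero]
      exact multiplicityWeight_nonneg ν x⟩
  integrable i := (integrable_const _).indicator
    (measurable_spectralMultiplicity hρ (measurableSet_singleton _))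
  integral_le i := by
    have := setIntegral_multiplicityDensity ν hρ i Set.univ (by simp)
    rw [Measure.restrict_univ] at this
    exact this.le

variable {N : Type*} [NormedAddCommGroup N] [InnerProductSpace ℂ N]
  (b : HilbertBasis (MultiplicityIndex ν ρ) ℂ N)

open Classical in
/-- The basis vector that represents the `n`-th measure at the point `x`. -/
def rankVector (n : ℕ) (x : ℝ) : N :=
  if h : 0 < ρ n x ∧ ν (spectralMultiplicity ρ ⁻¹' {spectralMultiplicity ρ x}) ≠ 0 then
    b ⟨(spectralMultiplicity ρ x, positiveRank ρ n x), positiveRank_lt_spectralMultiplicity h.1, h.2⟩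
  else 0

omit [IsFiniteMeasure ν] in
open Classical in
-- The condition of non-zero measure disappears, because it is part of the index `i`.
theorem inner_rankVector (n : ℕ) (x : ℝ) (i : MultiplicityIndex ν ρ) :
    ⟪b i, rankVector ν b n x⟫_ℂ =
      if 0 < ρ n x ∧ spectralMultiplicity ρ x = i.1.1 ∧ positiveRank ρ n x = i.1.2 then 1 else 0 := by
  unfold rankVector
  split_ifs with h1 h2 h2
  · have : i = ⟨(spectralMultiplicity ρ x, positiveRank ρ n x), positiveRank_lt_spectralMultiplicity h1.1, h1.2⟩ :=
      Subtype.ext (Prod.ext h2.2.1.symm h2.2.2.symm)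
    rw [this, inner_self_eq_norm_sq_to_K, b.orthonormal.1]
    simp
  · refine b.orthonormal.2 fun h => h2 ⟨h1.1, ?_, ?_⟩ <;> rw [h]
  · exact absurd ⟨h2.1, by rw [h2.2.1]; exact i.2.2⟩ h1
  · exact inner_zero_right _

omit [IsFiniteMeasure ν] in
theorem stronglyMeasurable_rankVector (hρ : ∀ n, Measurable (ρ n)) (n : ℕ) :
    StronglyMeasurable (rankVector ν b n) := by
  classical
  refine b.stronglyMeasurable_of_inner fun i => ?_
  simp only [inner_rankVector]
  refine StronglyMeasurable.ite ?_ stronglyMeasurable_const stronglyMeasurable_const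
  exact (measurableSet_lt measurable_const (hρ n)).inter
    ((measurable_spectralMultiplicity hρ (measurableSet_singleton _)).inter
      (measurable_positiveRank hρ n (measurableSet_singleton _)))

omit [IsFiniteMeasure ν] in
theorem norm_rankVector_le (n : ℕ) (x : ℝ) : ‖rankVector ν b n x‖ ≤ 1 := by
  unfold rankVector
  split_ifs
  · exact (b.orthonormal.1 _).le
  · simp

omit [IsFiniteMeasure ν] in
theorem norm_rankVector {n : ℕ} {x : ℝ} (h1 : 0 < ρ n x)
    (h2 : ν (spectralMultiplicity ρ ⁻¹' {spectralMultiplicity ρ x}) ≠ 0) : ‖rankVector ν b n x‖ = 1 := by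
  unfold rankVector
  rw [dif_pos ⟨h1, h2⟩]
  exact b.orthonormal.1 _

omit [IsFiniteMeasure ν] in
theorem rankVector_of_not_pos {n : ℕ} {x : ℝ} (h : ¬ 0 < ρ n x) : rankVector ν b n x = 0 :=
  dif_neg fun h' => h h'.1

omit [IsFiniteMeasure ν] in
theorem inner_rankVector_of_ne {m n : ℕ} (hmn : m ≠ n) (x : ℝ) :
    ⟪rankVector ν b m x, rankVector ν b n x⟫_ℂ = 0 := by
  by_cases hm : 0 < ρ m x ∧ ν (spectralMultiplicity ρ ⁻¹' {spectralMultiplicity ρ x}) ≠ 0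
  · have e : rankVector ν b m x = b ⟨(spectralMultiplicity ρ x, positiveRank ρ m x),
      positiveRank_lt_spectralMultiplicity hm.1, hm.2⟩ := dif_pos hm
    rw [e, inner_rankVector, if_neg]
    rintro ⟨h1, -, h2⟩
    exact hmn (positiveRank_injective h1 hm.1 h2).symm
  · have e : rankVector ν b m x = 0 := dif_neg hm
    rw [e, inner_zero_left]

theorem root_rankVector (hρ : ∀ n, Measurable (ρ n)) (n : ℕ) (x : ℝ) :
    IsDiagonalDensity.root b (multiplicityDensity ν ρ) x (rankVector ν b n x) =
      ((√(multiplicityWeight ν ρ x) : ℝ) : ℂ) • rankVector ν b n x := by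
  refine b.ext_inner fun i => ?_
  rw [(isDiagonalDensity_multiplicity ν hρ).inner_root, inner_smul_right, inner_rankVector]
  split_ifs with h
  · rw [multiplicityDensity_of_eq ν h.2.1]
  · simp

omit [IsFiniteMeasure ν] in
theorem exists_rankVector_eq {x : ℝ} {i : MultiplicityIndex ν ρ} (h : spectralMultiplicity ρ x = i.1.1) :
    ∃ n, rankVector ν b n x = b i := by
  obtain ⟨n, h1, h2⟩ := exists_of_lt_spectralMultiplicity (h ▸ i.2.1)
  refine ⟨n, (dif_pos ⟨h1, by rw [h]; exact i.2.2⟩).trans ?_⟩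
  congr 1
  exact Subtype.ext (Prod.ext h h2)

/-- The projection onto the basis vectors that belong to the multiplicity at the point `x`. -/
def multiplicityProj (x : ℝ) : N →L[ℂ] N :=
  b.diag fun i => (spectralMultiplicity ρ ⁻¹' {i.1.1}).indicator 1 x

omit [IsFiniteMeasure ν] in
theorem abs_indicator_multiplicity_le (x : ℝ) (i : MultiplicityIndex ν ρ) :
    |(spectralMultiplicity ρ ⁻¹' {i.1.1}).indicator (1 : ℝ → ℝ) x| ≤ 1 := by
  by_cases h : x ∈ spectralMultiplicity ρ ⁻¹' {i.1.1}
  · rw [Set.indicator_of_mem h]; simp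
  · rw [Set.indicator_of_notMem h]; simp

omit [IsFiniteMeasure ν] in
open Classical in
theorem inner_multiplicityProj (x : ℝ) (v : N) (i : MultiplicityIndex ν ρ) :
    ⟪b i, multiplicityProj ν b x v⟫_ℂ =
      if spectralMultiplicity ρ x = i.1.1 then ⟪b i, v⟫_ℂ else 0 := by
  rw [multiplicityProj, b.inner_diag ⟨1, abs_indicator_multiplicity_le ν x⟩]
  split_ifs with h
  · rw [Set.indicator_of_mem (by exact h)]; simp
  · rw [Set.indicator_of_notMem (by exact h)]; simp

omit [IsFiniteMeasure ν] in
theorem norm_multiplicityProj_le (x : ℝ) : ‖multiplicityProj ν b x‖ ≤ 1 :=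
  b.norm_diag_le zero_le_one (abs_indicator_multiplicity_le ν x)

omit [IsFiniteMeasure ν] in
theorem multiplicityProj_isPositive (x : ℝ) : (multiplicityProj ν b x).IsPositive :=
  b.diag_isPositive ⟨1, abs_indicator_multiplicity_le ν x⟩ fun _ =>
    Set.indicator_nonneg (fun _ _ => zero_le_one) _

omit [IsFiniteMeasure ν] in
theorem stronglyMeasurable_multiplicityProj (hρ : ∀ n, Measurable (ρ n)) (v : N) :
    StronglyMeasurable fun x => multiplicityProj ν b x v :=
  b.stronglyMeasurable_diag
    (fun _ => measurable_one.indicator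
      (measurable_spectralMultiplicity hρ (measurableSet_singleton _)))
    (fun x => ⟨1, abs_indicator_multiplicity_le ν x⟩) v

omit [IsFiniteMeasure ν] in
theorem multiplicityProj_multiplicityProj (x : ℝ) (v : N) :
    multiplicityProj ν b x (multiplicityProj ν b x v) = multiplicityProj ν b x v := by
  refine b.ext_inner fun i => ?_
  simp only [inner_multiplicityProj]
  split_ifs <;> rfl

/-- At a given point all non-zero eigenvalues of the density coincide. This is the purpose of
sorting by multiplicity: the density and its root commute with every operator that the fibre
projection fixes from both sides. -/
theorem root_eq_smul_multiplicityProj (hρ : ∀ n, Measurable (ρ n)) (x : ℝ) (v : N) :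
    IsDiagonalDensity.root b (multiplicityDensity ν ρ) x v =
      ((√(multiplicityWeight ν ρ x) : ℝ) : ℂ) • multiplicityProj ν b x v := by
  refine b.ext_inner fun i => ?_
  rw [(isDiagonalDensity_multiplicity ν hρ).inner_root, inner_smul_right, inner_multiplicityProj]
  split_ifs with h
  · rw [multiplicityDensity_of_eq ν h]
  · rw [multiplicityDensity_of_ne ν h]; simp

theorem density_eq_smul_multiplicityProj (hρ : ∀ n, Measurable (ρ n)) (x : ℝ) :
    (b.diag fun i => multiplicityDensity ν ρ i x) =
      (multiplicityWeight ν ρ x : ℂ) • multiplicityProj ν b x := by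
  refine ContinuousLinearMap.ext fun v => b.ext_inner fun i => ?_
  rw [b.inner_diag ((isDiagonalDensity_multiplicity ν hρ).bounded x), smul_apply,
    inner_smul_right, inner_multiplicityProj]
  split_ifs with h
  · rw [multiplicityDensity_of_eq ν h]
  · rw [multiplicityDensity_of_ne ν h]; simp

end Multiplicity

/-! ### Identification of `⊕ L²(μ n)` with `L²(N, dF)`. -/

section Representation

/-- The densities of a sequence of measures with respect to a given one. -/
def realDensity (μ : ℕ → Measure ℝ) (ν : Measure ℝ) (n : ℕ) (x : ℝ) : ℝ :=
  ((μ n).rnDeriv ν x).toReal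

variable {μ : ℕ → Measure ℝ} {ν : Measure ℝ}

theorem measurable_realDensity (μ : ℕ → Measure ℝ) (ν : Measure ℝ) (n : ℕ) :
    Measurable (realDensity μ ν n) :=
  (Measure.measurable_rnDeriv _ _).ennreal_toReal

theorem realDensity_nonneg (n : ℕ) (x : ℝ) : 0 ≤ realDensity μ ν n x := ENNReal.toReal_nonneg

theorem ae_of_realDensity_pos [∀ n, IsFiniteMeasure (μ n)] [IsFiniteMeasure ν]
    (hμν : ∀ n, μ n ≪ ν) {n : ℕ} {p : ℝ → Prop} (h : ∀ᵐ x ∂μ n, p x) :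
    ∀ᵐ x ∂ν, 0 < realDensity μ ν n x → p x := by
  rw [← Measure.withDensity_rnDeriv_eq (μ n) ν (hμν n),
    ae_withDensity_iff (Measure.measurable_rnDeriv _ _)] at h
  filter_upwards [h] with x hx h0
  exact hx fun h1 => by simp [realDensity, h1] at h0

variable (μ) in
theorem isDiagonalDensity_realDensity [IsFiniteMeasure ν] :
    IsDiagonalDensity ν (multiplicityDensity ν (realDensity μ ν)) :=
  isDiagonalDensity_multiplicity ν (measurable_realDensity μ ν)

variable {N : Type*} [NormedAddCommGroup N] [InnerProductSpace ℂ N]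
  (b : HilbertBasis (MultiplicityIndex ν (realDensity μ ν)) ℂ N)

/-- The field of vectors that represents the function `h` in the `n`-th space. -/
def vectorField (n : ℕ) (h : ℝ → ℂ) (x : ℝ) : N :=
  ((√(realDensity μ ν n x) : ℝ) * h x) • rankVector ν b n x

theorem stronglyMeasurable_vectorField (n : ℕ) {h : ℝ → ℂ} (hh : StronglyMeasurable h) :
    StronglyMeasurable (vectorField b n h) :=
  ((Complex.measurable_ofReal.comp (measurable_realDensity μ ν n).sqrt).stronglyMeasurable.mul
    hh).smul (stronglyMeasurable_rankVector ν b (measurable_realDensity μ ν) n)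

/-- The rank vector is a unit vector where the density is positive, and the factor `√ρ` converts
integration against `ν` into integration against `μ n`. -/
theorem norm_vectorField_sq (n : ℕ) (h : ℝ → ℂ) :
    (fun x => ‖vectorField b n h x‖ ^ 2) =ᵐ[ν] fun x => realDensity μ ν n x • ‖h x‖ ^ 2 := by
  filter_upwards [ae_multiplicity_ne_zero ν (ρ := realDensity μ ν)] with x hx
  rw [vectorField, norm_smul, norm_mul, Complex.norm_real, Real.norm_of_nonneg (Real.sqrt_nonneg _),
    mul_pow, mul_pow, Real.sq_sqrt (realDensity_nonneg n x), smul_eq_mul]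
  by_cases h0 : 0 < realDensity μ ν n x
  · rw [norm_rankVector ν b h0 hx, one_pow, mul_one]
  · rw [le_antisymm (not_lt.1 h0) (realDensity_nonneg n x)]
    simp

variable [∀ n, IsFiniteMeasure (μ n)] [IsFiniteMeasure ν] (hμν : ∀ n, μ n ≪ ν)

include hμν in
theorem vectorField_congr (n : ℕ) {g h : ℝ → ℂ} (hgh : g =ᵐ[μ n] h) :
    vectorField b n g =ᵐ[ν] vectorField b n h := by
  filter_upwards [ae_of_realDensity_pos hμν hgh] with x hx
  by_cases h0 : 0 < realDensity μ ν n x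
  · rw [vectorField, vectorField, hx h0]
  · rw [vectorField, vectorField, rankVector_of_not_pos ν b h0, smul_zero, smul_zero]

include hμν in
theorem memLp_vectorField (n : ℕ) (h : Lp ℂ 2 (μ n)) : MemLp (vectorField b n h) 2 ν := by
  rw [memLp_two_iff_integrable_sq_norm
    (stronglyMeasurable_vectorField b n (Lp.stronglyMeasurable h)).aestronglyMeasurable,
    integrable_congr (norm_vectorField_sq b n h)]
  exact (integrable_rnDeriv_smul_iff (hμν n)).2 ((Lp.memLp h).integrable_norm_pow two_ne_zero)

include hμν in
theorem exists_vectorField_isometry (n : ℕ) :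
    ∃ Y : Lp ℂ 2 (μ n) →ₗᵢ[ℂ] Lp N 2 ν, ∀ h, Y h =ᵐ[ν] vectorField b n h := by
  refine ⟨⟨{ toFun := fun h => (memLp_vectorField b hμν n h).toLp _
             map_add' := fun g h => ?_
             map_smul' := fun c h => ?_ }, fun h => ?_⟩, fun h =>
    (memLp_vectorField b hμν n h).coeFn_toLp⟩
  · rw [← MemLp.toLp_add, MemLp.toLp_eq_toLp_iff]
    refine (vectorField_congr b hμν n (Lp.coeFn_add g h)).trans ?_
    refine Filter.Eventually.of_forall fun x => ?_
    simp only [vectorField, Pi.add_apply, mul_add, add_smul]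
  · rw [RingHom.id_apply, ← MemLp.toLp_const_smul, MemLp.toLp_eq_toLp_iff]
    refine (vectorField_congr b hμν n (Lp.coeFn_smul c h)).trans ?_
    refine Filter.Eventually.of_forall fun x => ?_
    simp only [vectorField, Pi.smul_apply, smul_smul, smul_eq_mul]
    congr 1
    ring
  · have h1 : ‖(memLp_vectorField b hμν n h).toLp _‖ ^ 2 = ‖h‖ ^ 2 := by
      rw [Lp_norm_sq_eq_integral, Lp_norm_sq_eq_integral, ← integral_rnDeriv_smul (hμν n)]
      refine integral_congr_ae ?_
      filter_upwards [(memLp_vectorField b hμν n h).coeFn_toLp, norm_vectorField_sq b n h]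
        with x h1 h2
      rw [h1, h2]
      rfl
    exact (sq_eq_sq₀ (norm_nonneg _) (norm_nonneg _)).1 h1

include hμν in
/-- An element orthogonal to all fields of vectors is orthogonal to the rank vectors pointwise. -/
theorem ae_inner_rankVector_eq_zero (n : ℕ) (g : Lp N 2 ν)
    (hg : ∀ h : Lp ℂ 2 (μ n), ∫ x, ⟪vectorField b n h x, g x⟫_ℂ ∂ν = 0) :
    ∀ᵐ x ∂ν, ⟪rankVector ν b n x, g x⟫_ℂ = 0 := by
  let u : ℝ → ℂ := fun x => ⟪rankVector ν b n x, g x⟫_ℂ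
  have hu : StronglyMeasurable u :=
    (stronglyMeasurable_rankVector ν b (measurable_realDensity μ ν) n).inner
      (Lp.stronglyMeasurable g)
  have hug : ∀ x, ‖u x‖ ≤ ‖g x‖ := fun x =>
    (norm_inner_le_norm _ _).trans (mul_le_of_le_one_left (norm_nonneg _)
      (norm_rankVector_le ν b n x))
  have hu2 : Integrable (fun x => ‖u x‖ ^ 2) ν :=
    (((Lp.memLp g).of_le hu.aestronglyMeasurable
      (Filter.Eventually.of_forall hug)).integrable_norm_pow two_ne_zero)
  -- Chosen so that its vector field is `u` times the rank vector; pairing with `g` then gives `∫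
  -- |u|²`. Where the density vanishes, so do the rank vector and `u`.
  let h₀ : ℝ → ℂ := fun x => ((√(realDensity μ ν n x))⁻¹ : ℝ) * u x
  have hh₀ : StronglyMeasurable h₀ :=
    (Complex.measurable_ofReal.comp
      (measurable_realDensity μ ν n).sqrt.inv).stronglyMeasurable.mul hu
  have e1 : ∀ x, realDensity μ ν n x • ‖h₀ x‖ ^ 2 = ‖u x‖ ^ 2 := by
    intro x
    by_cases h0 : 0 < realDensity μ ν n x
    · simp only [h₀]
      rw [norm_mul, Complex.norm_real, norm_inv, Real.norm_of_nonneg (Real.sqrt_nonneg _), mul_pow,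
        inv_pow, Real.sq_sqrt h0.le, smul_eq_mul, ← mul_assoc, mul_inv_cancel₀ h0.ne', one_mul]
    · have : u x = 0 := by
        simp only [u]
        rw [rankVector_of_not_pos ν b h0, inner_zero_left]
      simp [h₀, this]
  have hmem : MemLp h₀ 2 (μ n) := by
    rw [memLp_two_iff_integrable_sq_norm hh₀.aestronglyMeasurable,
      ← integrable_rnDeriv_smul_iff (hμν n)]
    exact hu2.congr (Filter.Eventually.of_forall fun x => (e1 x).symm)
  have h1 := hg (hmem.toLp h₀)
  have h2 : ∫ x, ⟪vectorField b n (hmem.toLp h₀) x, g x⟫_ℂ ∂ν =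
      ((∫ x, ‖u x‖ ^ 2 ∂ν : ℝ) : ℂ) := by
    rw [← integral_complex_ofReal]
    refine integral_congr_ae ?_
    filter_upwards [vectorField_congr b hμν n hmem.coeFn_toLp] with x hx
    rw [hx, vectorField, inner_smul_left]
    change _ * u x = _
    by_cases h0 : 0 < realDensity μ ν n x
    · have h3 : ((√(realDensity μ ν n x) : ℝ) : ℂ) ≠ 0 :=
        Complex.ofReal_ne_zero.2 (Real.sqrt_pos.2 h0).ne'
      simp only [h₀, Complex.ofReal_inv]
      rw [← mul_assoc, mul_inv_cancel₀ h3, one_mul, mul_comm, Complex.mul_conj,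
        Complex.normSq_eq_norm_sq]
    · have : u x = 0 := by
        simp only [u]
        rw [rankVector_of_not_pos ν b h0, inner_zero_left]
      simp [this]
  rw [h1] at h2
  have h3 := (integral_eq_zero_iff_of_nonneg (fun x => sq_nonneg _) hu2).1
    (Complex.ofReal_eq_zero.1 h2.symm)
  filter_upwards [h3] with x hx
  exact norm_eq_zero.1 (pow_eq_zero_iff two_ne_zero |>.1 hx)

variable (h0 : ν {0} = 0)

omit [∀ n, IsFiniteMeasure (μ n)] in
-- Elements of the range of `X` take values in the fibres: for functions because the root is a
-- multiple of the projection, in general because the condition is closed.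
theorem ae_multiplicityProj_eq
    {X : ((isDiagonalDensity_realDensity μ).operatorMeasure b h0).L2 →ₗᵢ[ℂ] Lp N 2 ν}
    (hX : ∀ f hf, X (((isDiagonalDensity_realDensity μ).operatorMeasure b h0).toL2 f hf) =ᵐ[ν]
      fun x => IsDiagonalDensity.root b (multiplicityDensity ν (realDensity μ ν)) x (f x))
    (y : ((isDiagonalDensity_realDensity μ).operatorMeasure b h0).L2) :
    ∀ᵐ x ∂ν, multiplicityProj ν b x (X y x) = X y x := by
  obtain ⟨T, hT⟩ := exists_multiplication ν
    (stronglyMeasurable_multiplicityProj ν b (measurable_realDensity μ ν))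
    (norm_multiplicityProj_le ν b)
  have h1 : T (X y) = X y := by
    refine OperatorMeasure.induction_L2 _ (p := fun y => T (X y) = X y)
      (isClosed_eq (by fun_prop) (by fun_prop)) (fun f hf => Lp.ext ?_) y
    filter_upwards [hT (X (((isDiagonalDensity_realDensity μ).operatorMeasure b h0).toL2 f hf)),
      hX f hf] with x h1 h2
    rw [h1, h2, root_eq_smul_multiplicityProj ν b (measurable_realDensity μ ν), map_smul,
      multiplicityProj_multiplicityProj]
  filter_upwards [hT (X y)] with x hx
  rw [← hx, h1]

include hμν in
/-- The space `L²(N, dF)` as an orthogonal sum of the spaces `L²(μ n)`. -/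
theorem exists_isHilbertSum_vectorField
    {X : ((isDiagonalDensity_realDensity μ).operatorMeasure b h0).L2 →ₗᵢ[ℂ] Lp N 2 ν}
    (hX : ∀ f hf, X (((isDiagonalDensity_realDensity μ).operatorMeasure b h0).toL2 f hf) =ᵐ[ν]
      fun x => IsDiagonalDensity.root b (multiplicityDensity ν (realDensity μ ν)) x (f x)) :
    ∃ Z : ∀ n, Lp ℂ 2 (μ n) →ₗᵢ[ℂ] ((isDiagonalDensity_realDensity μ).operatorMeasure b h0).L2,
      (∀ n h, X (Z n h) =ᵐ[ν] vectorField b n h) ∧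
      IsHilbertSum ℂ (fun n => Lp ℂ 2 (μ n)) Z := by
  let F := (isDiagonalDensity_realDensity μ).operatorMeasure b h0
  have hroot := root_rankVector ν b (measurable_realDensity μ ν)
  choose Y hY using exists_vectorField_isometry b hμν
  have hmem : ∀ n h, ∃ y, X y = Y n h := by
    intro n h
    -- The root multiplies a rank vector by the square root of the weight, so dividing by it
    -- exhibits the vector field as an element of the range of `X`.
    let f : ℝ → N := fun x => ((√(multiplicityWeight ν (realDensity μ ν) x))⁻¹ : ℝ) •
      vectorField b n h x
    have hf : ∀ x, IsDiagonalDensity.root b (multiplicityDensity ν (realDensity μ ν)) x (f x) =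
        vectorField b n h x := by
      intro x
      simp only [f, vectorField]
      rw [← Complex.coe_smul, smul_smul, map_smul, hroot, smul_smul]
      by_cases hx : ν (spectralMultiplicity (realDensity μ ν) ⁻¹'
          {spectralMultiplicity (realDensity μ ν) x}) = 0
      · have : rankVector ν b n x = 0 := dif_neg fun h' => h'.2 hx
        rw [this, smul_zero, smul_zero]
      · have h1 : 0 < multiplicityWeight ν (realDensity μ ν) x :=
          inv_pos.2 (ENNReal.toReal_pos hx (measure_ne_top _ _))
        have h2 : ((√(multiplicityWeight ν (realDensity μ ν) x) : ℝ) : ℂ) ≠ 0 :=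
          Complex.ofReal_ne_zero.2 (Real.sqrt_pos.2 h1).ne'
        congr 1
        rw [Complex.ofReal_inv]
        field_simp
    have hfm : StronglyMeasurable f :=
      ((measurable_multiplicityWeight ν (measurable_realDensity μ ν)).sqrt.inv).stronglyMeasurable.smul
        (stronglyMeasurable_vectorField b n (Lp.stronglyMeasurable h))
    have hfs : F.SqIntegrable f := by
      rw [(isDiagonalDensity_realDensity μ).sqIntegrable_iff b h0 f hfm.aestronglyMeasurable]
      simp only [hf]
      exact memLp_vectorField b hμν n h
    refine ⟨F.toL2 f hfs, Lp.ext ?_⟩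
    refine (hX f hfs).trans ?_
    simp only [hf]
    exact (hY n h).symm
  choose z hz using hmem
  let Z : ∀ n, Lp ℂ 2 (μ n) →ₗᵢ[ℂ] F.L2 := fun n =>
    { toFun := z n
      map_add' := fun g h => X.injective (by rw [map_add, hz, hz, hz, map_add])
      map_smul' := fun c h => X.injective (by
        rw [RingHom.id_apply, map_smul, hz, hz, map_smul])
      norm_map' := fun h => by
        change ‖z n h‖ = _
        rw [← X.norm_map, hz, (Y n).norm_map] }
  have hZ : ∀ n h, X (Z n h) =ᵐ[ν] vectorField b n h := fun n h => by
    change X (z n h) =ᵐ[ν] _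
    rw [hz]
    exact hY n h
  refine ⟨Z, hZ, IsHilbertSum.mk ?_ ?_⟩
  · intro m n hmn g h
    rw [← X.inner_map_map, L2.inner_def]
    refine integral_eq_zero_of_ae ?_
    filter_upwards [hZ m g, hZ n h] with x h1 h2
    rw [h1, h2, vectorField, vectorField, inner_smul_left, inner_smul_right,
      inner_rankVector_of_ne ν b hmn, mul_zero, mul_zero]
    rfl
  · rw [top_le_iff, Submodule.topologicalClosure_eq_top_iff, Submodule.eq_bot_iff]
    intro y hy
    have hy1 : ∀ n h, ⟪Z n h, y⟫_ℂ = 0 := fun n h =>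
      (Submodule.mem_orthogonal _ _).1 hy _ (Submodule.mem_iSup_of_mem n ⟨_, rfl⟩)
    have hy2 : ∀ n, ∀ᵐ x ∂ν, ⟪rankVector ν b n x, X y x⟫_ℂ = 0 := by
      intro n
      refine ae_inner_rankVector_eq_zero b hμν n (X y) fun h => ?_
      rw [← hy1 n h, ← X.inner_map_map, L2.inner_def]
      refine integral_congr_ae ?_
      filter_upwards [hZ n h] with x hx
      rw [hx]
    have hy3 : ∀ i, ∀ᵐ x ∂ν, spectralMultiplicity (realDensity μ ν) x ≠ i.1.1 →
        ⟪b i, X y x⟫_ℂ = 0 := by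
      intro i
      filter_upwards [ae_multiplicityProj_eq b h0 hX y] with x hx hi
      rw [← hx, inner_multiplicityProj, if_neg hi]
    -- Within the fibre every basis vector is a rank vector, and outside the fibre the coordinates
    -- vanish.
    have hy4 : X y = 0 := by
      refine Lp.ext ?_
      filter_upwards [ae_all_iff.2 hy2, ae_all_iff.2 hy3, Lp.coeFn_zero N 2 ν] with x h2 h3 h4
      rw [h4]
      refine b.ext_inner fun i => ?_
      rw [Pi.zero_apply, inner_zero_right]
      by_cases hi : spectralMultiplicity (realDensity μ ν) x = i.1.1
      · obtain ⟨n, hn⟩ := exists_rankVector_eq ν b hi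
        rw [← hn]
        exact h2 n
      · exact h3 i hi
    exact X.injective (hy4.trans (map_zero X).symm)

end Representation

/-! ### The model of a commuting pair: positive injective `C`, non-negative `P`. -/

section Model

open scoped BoundedContinuousFunction

theorem HilbertBasis.separableSpace {ι N : Type*} [Countable ι] [NormedAddCommGroup N]
    [InnerProductSpace ℂ N] (b : HilbertBasis ι ℂ N) : TopologicalSpace.SeparableSpace N := by
  have h1 : TopologicalSpace.IsSeparable (Submodule.span ℂ (Set.range b) : Set N) :=
    (Set.countable_range b).isSeparable.span
  have h2 := h1.closure
  have h3 : closure (Submodule.span ℂ (Set.range b) : Set N) = Set.univ := by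
    have := congrArg (fun L : Submodule ℂ N => (L : Set N)) b.dense_span
    exact this
  rw [h3] at h2
  exact TopologicalSpace.isSeparable_univ_iff.1 h2

theorem IsHilbertSum.clm_ext {ι K E : Type*} {G : ι → Type*} [NormedAddCommGroup K]
    [InnerProductSpace ℂ K] [CompleteSpace K] [NormedAddCommGroup E] [NormedSpace ℂ E]
    [∀ i, NormedAddCommGroup (G i)] [∀ i, InnerProductSpace ℂ (G i)] {V : ∀ i, G i →ₗᵢ[ℂ] K}
    (hV : IsHilbertSum ℂ G V) {S T : K →L[ℂ] E} (h : ∀ i g, S (V i g) = T (V i g)) : S = T := by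
  refine ContinuousLinearMap.ext fun k => ?_
  obtain ⟨w, rfl⟩ := hV.linearIsometryEquiv.symm.surjective k
  have h1 := hV.hasSum_linearIsometryEquiv_symm w
  have h2 := h1.mapL S
  have h3 := h1.mapL T
  simp only [h] at h2
  exact h2.unique h3

variable {K : Type*} [NormedAddCommGroup K] [InnerProductSpace ℂ K] [CompleteSpace K]
  {C P : K →L[ℂ] K}

theorem spectrum_subset_Icc_of_isPositive (hC : C.IsPositive) {R : ℝ} (hR : ‖C‖ ≤ R) :
    spectrum ℝ C ⊆ Set.Icc 0 R := by
  intro x hx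
  have h0 : 0 ≤ x := spectrum_nonneg_of_nonneg ((ContinuousLinearMap.nonneg_iff_isPositive C).2 hC) hx
  refine ⟨h0, ?_⟩
  rcases subsingleton_or_nontrivial K with hK | hK
  · have : Subsingleton (K →L[ℂ] K) := ⟨fun S T => ContinuousLinearMap.ext fun k =>
      Subsingleton.elim _ _⟩
    rw [spectrum.of_subsingleton] at hx
    exact hx.elim
  · exact (le_abs_self x).trans ((spectrum.norm_le_norm_of_mem hx).trans hR)

/-- The identity function, cut off outside `[0, R]`. -/
def cutoff (R : ℝ) : ℝ →ᵇ ℂ :=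
  BoundedContinuousFunction.ofNormedAddCommGroup (fun x => ((max 0 (min x R) : ℝ) : ℂ))
    (by fun_prop) |R| fun x => by
      rw [Complex.norm_real, Real.norm_eq_abs, abs_of_nonneg (le_max_left _ _)]
      exact max_le (abs_nonneg _) ((min_le_right _ _).trans (le_abs_self R))

theorem cutoff_of_mem {R x : ℝ} (hx : x ∈ Set.Icc 0 R) : cutoff R x = x := by
  change ((max 0 (min x R) : ℝ) : ℂ) = x
  rw [min_eq_left hx.2, max_eq_right hx.1]

/-- The spectrum lies in `[0, R]`, where the cut-off function is the identity. So `C` itself is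
covered by statements about bounded continuous functions on the line. -/
theorem selfAdjointCalculus_cutoff (hC : C.IsPositive) {R : ℝ} (hR : ‖C‖ ≤ R) :
    selfAdjointCalculus C (cutoff R) = C := by
  have h1 := selfAdjointCalculus_ofReal hC.isSelfAdjoint fun x => max 0 (min x R)
  refine Eq.trans h1 ((cfc_congr fun x hx => ?_).trans (cfc_id' ℝ C hC.isSelfAdjoint))
  have := spectrum_subset_Icc_of_isPositive hC hR hx
  rw [min_eq_left this.2, max_eq_right this.1]

/-- The spectral representation of a positive injective operator of norm at most `R`; the measures
live on `(0, R]`. -/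
theorem exists_positive_spectral_representation [TopologicalSpace.SeparableSpace K]
    (hC : C.IsPositive) (hC0 : ∀ h, C h = 0 → h = 0) {R : ℝ} (hR : ‖C‖ ≤ R) :
    ∃ (μ : ℕ → Measure ℝ) (_ : ∀ n, IsFiniteMeasure (μ n)) (V : ∀ n, Lp ℂ 2 (μ n) →ₗᵢ[ℂ] K),
      (∀ n, μ n (Set.Ioc 0 R)ᶜ = 0) ∧ IsHilbertSum ℂ (fun n => Lp ℂ 2 (μ n)) V ∧
      ∀ n (φ : ℝ →ᵇ ℂ) (g h : Lp ℂ 2 (μ n)), g =ᵐ[μ n] (fun x => φ x * h x) →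
        V n g = selfAdjointCalculus C φ (V n h) := by
  obtain ⟨μ, hfin, V, hμ, hV, hφ⟩ := exists_spectral_representation hC.isSelfAdjoint
  refine ⟨μ, hfin, V, fun n => ?_, hV, hφ⟩
  -- Multiplication by the variable kills the indicator of `{0}`, so an atom there would produce a
  -- vector in the kernel of `C`.
  have hz : μ n {0} = 0 := by
    let g : Lp ℂ 2 (μ n) := indicatorConstLp 2 (measurableSet_singleton (0 : ℝ))
      (measure_ne_top _ _) 1
    have h1 : V n 0 = selfAdjointCalculus C (cutoff R) (V n g) := by
      refine hφ n (cutoff R) 0 g ?_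
      filter_upwards [Lp.coeFn_zero ℂ 2 (μ n), indicatorConstLp_coeFn (p := 2) (μ := μ n)
        (hs := measurableSet_singleton (0 : ℝ)) (hμs := measure_ne_top _ _) (c := (1 : ℂ))]
        with x h1 h2
      rw [h1, h2]
      by_cases hx : x = 0
      · have : cutoff R 0 = 0 := by
          change ((max 0 (min 0 R) : ℝ) : ℂ) = 0
          simp
        rw [hx, this, zero_mul, Pi.zero_apply]
      · rw [Set.indicator_of_notMem (by simpa using hx), mul_zero, Pi.zero_apply]
    rw [selfAdjointCalculus_cutoff hC hR, map_zero] at h1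
    have h2 : g = 0 := (V n).injective ((hC0 _ h1.symm).trans (map_zero _).symm)
    have h3 : ‖g‖ = 0 := by rw [h2, norm_zero]
    rw [norm_indicatorConstLp (by norm_num) (by norm_num)] at h3
    simp only [norm_one, one_mul] at h3
    have h4 := (Real.rpow_eq_zero measureReal_nonneg (by norm_num)).1 h3
    exact (measureReal_eq_zero_iff).1 h4
  refine measure_mono_null (t := (spectrum ℝ C)ᶜ ∪ {0}) (fun x hx => ?_)
    (measure_union_null (hμ n) hz)
  by_contra hx'
  simp only [Set.mem_union, Set.mem_compl_iff, not_or, not_not, Set.mem_singleton_iff] at hx'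
  have := spectrum_subset_Icc_of_isPositive hC hR hx'.1
  exact hx ⟨lt_of_le_of_ne this.1 (Ne.symm hx'.2), this.2⟩

variable {N : Type*} [NormedAddCommGroup N] [InnerProductSpace ℂ N] [CompleteSpace N]
  {ν : Measure ℝ}

/-- The compression to `L²(ν; N)` of an operator that commutes with `C` commutes with the
multiplications, when `C` is represented by the multiplication by the variable. -/
theorem ae_conj_adjoint_commute (hC : IsSelfAdjoint C) (hCP : Commute C P) {Y : K →L[ℂ] Lp N 2 ν}
    (hY : ∀ (φ : ℝ →ᵇ ℂ) k, Y (selfAdjointCalculus C φ k) =ᵐ[ν] fun x => φ x • Y k x)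
    (φ : ℝ →ᵇ ℂ) (g h : Lp N 2 ν) (hgh : h =ᵐ[ν] fun x => φ x • g x) :
    (Y ∘L P ∘L ContinuousLinearMap.adjoint Y) h =ᵐ[ν]
      fun x => φ x • (Y ∘L P ∘L ContinuousLinearMap.adjoint Y) g x := by
  -- Taking adjoints in the intertwining relation for `star φ` shows that `Y*` intertwines as well.
  have h1 : ContinuousLinearMap.adjoint Y h =
      selfAdjointCalculus C φ (ContinuousLinearMap.adjoint Y g) := by
    refine ext_inner_left ℂ fun k => ?_
    have e1 : ⟪k, selfAdjointCalculus C φ (ContinuousLinearMap.adjoint Y g)⟫_ℂ =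
        ⟪Y (selfAdjointCalculus C (star φ : ℝ →ᵇ ℂ) k), g⟫_ℂ := by
      rw [← ContinuousLinearMap.adjoint_inner_right Y]
      have : ((star φ : ℝ →ᵇ ℂ) : ℝ → ℂ) = fun x => star (φ x) := rfl
      rw [this, inner_selfAdjointCalculus_left]
      simp only [star_star]
    rw [e1, ContinuousLinearMap.adjoint_inner_right, L2.inner_def, L2.inner_def]
    refine integral_congr_ae ?_
    filter_upwards [hgh, hY (star φ) k] with x h1 h2
    rw [h1, h2, inner_smul_right, inner_smul_left]
    congr 1
    change φ x = star (star (φ x))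
    rw [star_star]
  have h2 : P (ContinuousLinearMap.adjoint Y h) =
      selfAdjointCalculus C φ (P (ContinuousLinearMap.adjoint Y g)) := by
    rw [h1]
    exact (congrArg (fun T : K →L[ℂ] K => T (ContinuousLinearMap.adjoint Y g))
      (commute_selfAdjointCalculus hC hCP φ).eq).symm
  change Y (P (ContinuousLinearMap.adjoint Y h)) =ᵐ[ν] _
  rw [h2]
  exact hY φ _

end Model

section Model

open scoped BoundedContinuousFunction

variable {K : Type*} [NormedAddCommGroup K] [InnerProductSpace ℂ K] [CompleteSpace K]
  {C P : K →L[ℂ] K}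

/-- A positive injective operator and a non-negative operator that commutes with it are the
multiplications by the variable and by an operator function in a space `L²(N, dF)`. -/
theorem exists_model [TopologicalSpace.SeparableSpace K] (hC : C.IsPositive)
    (hC0 : ∀ h, C h = 0 → h = 0) (hP : P.IsPositive) (hCP : Commute C P) {R : ℝ} (hR : ‖C‖ ≤ R) :
    ∃ (N : Type) (_ : NormedAddCommGroup N) (_ : InnerProductSpace ℂ N) (_ : CompleteSpace N)
      (_ : TopologicalSpace.SeparableSpace N) (F : OperatorMeasure N) (n : ℝ → N →L[ℂ] N),
      F.base (Set.Iic 0) = 0 ∧ (∀ t, R ≤ t → F.dist t = 1) ∧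
      (∃ (ι : Type) (e : HilbertBasis ι ℂ N), ∀ i j, i ≠ j → ∀ t, ⟪e i, F.dist t (e j)⟫_ℂ = 0) ∧
      (∀ v, StronglyMeasurable fun x => n x v) ∧
      (∀ x, n (-x) = n x) ∧ (∀ x, (n x).IsPositive) ∧
      (∀ x, F.density |x| * n x = n x * F.density |x|) ∧
      ∃ (Q M : F.L2 →L[ℂ] F.L2) (W : K ≃ₗᵢ[ℂ] F.L2),
        F.ActsAs Q (fun f x => (x : ℂ) • f x) ∧ F.ActsAs M (fun f x => n x (f x)) ∧
        (∀ h, W (C h) = Q (W h)) ∧ ∀ h, W (P h) = M (W h) := by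
  have hR0 : 0 ≤ R := (norm_nonneg C).trans hR
  obtain ⟨μ, hfin, V, hμ, hV, hφ⟩ := exists_positive_spectral_representation hC hC0 hR
  -- A finite measure with the same null sets as the sum of the `μ n`.
  let ν : Measure ℝ := (Measure.sum μ).toFinite
  have hμν : ∀ n, μ n ≪ ν := fun n =>
    (Measure.absolutelyContinuous_of_le (Measure.le_sum μ n)).trans (absolutelyContinuous_toFinite _)
  have hν : ν (Set.Ioc 0 R)ᶜ = 0 := by
    refine toFinite_absolutelyContinuous _ ?_
    rw [Measure.sum_apply _ measurableSet_Ioc.compl]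
    simp [hμ]
  have hνae : ∀ᵐ x ∂ν, x ∈ Set.Ioc 0 R := mem_ae_iff.2 hν
  have h0 : ν {0} = 0 := measure_mono_null (by simp) hν
  let ρ := realDensity μ ν
  have hρ : ∀ n, Measurable (ρ n) := measurable_realDensity μ ν
  let N := lp (fun _ : MultiplicityIndex ν ρ => ℂ) 2
  let b : HilbertBasis (MultiplicityIndex ν ρ) ℂ N :=
    HilbertBasis.ofRepr (LinearIsometryEquiv.refl ℂ N)
  have hsep : TopologicalSpace.SeparableSpace N := b.separableSpace
  let a := multiplicityDensity ν ρ
  have ha : IsDiagonalDensity ν a := isDiagonalDensity_realDensity μ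
  let F : OperatorMeasure N := ha.operatorMeasure b h0
  obtain ⟨X, hX⟩ := ha.exists_root_isometry b h0
  obtain ⟨Z, hZ, hZsum⟩ := exists_isHilbertSum_vectorField b hμν h0 hX
  let W : K ≃ₗᵢ[ℂ] F.L2 := hV.linearIsometryEquiv.trans hZsum.linearIsometryEquiv.symm
  have hW : ∀ n g, W (V n g) = Z n g := by
    classical
    intro n g
    change hZsum.linearIsometryEquiv.symm (hV.linearIsometryEquiv (V n g)) = Z n g
    rw [← hV.linearIsometryEquiv_symm_apply_single, LinearIsometryEquiv.apply_symm_apply,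
      hZsum.linearIsometryEquiv_symm_apply_single]
  let Y : K →L[ℂ] Lp N 2 ν := X.toContinuousLinearMap ∘L (W : K →L[ℂ] F.L2)
  have hYV : ∀ n g, Y (V n g) =ᵐ[ν] vectorField b n g := by
    intro n g
    change X (W (V n g)) =ᵐ[ν] _
    rw [hW]
    exact hZ n g
  have hY : ∀ (φ : ℝ →ᵇ ℂ) k, Y (selfAdjointCalculus C φ k) =ᵐ[ν] fun x => φ x • Y k x := by
    intro φ k
    obtain ⟨Mφ, hMφ⟩ := exists_multiplication_boundedContinuous (E := N) ν φ
    have h1 : Y ∘L selfAdjointCalculus C φ = Mφ ∘L Y := by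
      refine hV.clm_ext fun n g => Lp.ext ?_
      obtain ⟨mφ, hmφ⟩ := exists_multiplication_boundedContinuous (E := ℂ) (μ n) φ
      change Y (selfAdjointCalculus C φ (V n g)) =ᵐ[ν] Mφ (Y (V n g))
      rw [← hφ n φ (mφ g) g (hmφ g)]
      filter_upwards [hYV n (mφ g), hYV n g, hMφ (Y (V n g)),
        vectorField_congr b hμν n (hmφ g)] with x h1 h2 h3 h4
      rw [h1, h3, h2, h4, vectorField, vectorField, smul_smul]
      congr 1
      simp only [smul_eq_mul]
      ring
    have h2 : Y (selfAdjointCalculus C φ k) = Mφ (Y k) :=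
      congrArg (fun S : K →L[ℂ] Lp N 2 ν => S k) h1
    rw [h2]
    exact hMφ _
  -- `P` carried to the range of `Y` and extended by `0` to its orthogonal complement.
  let T : Lp N 2 ν →L[ℂ] Lp N 2 ν := Y ∘L P ∘L ContinuousLinearMap.adjoint Y
  have hT : T.IsPositive := hP.conj_adjoint Y
  obtain ⟨n₀, hn₀m, hn₀p, hn₀b, hn₀⟩ :=
    exists_decomposition b hT (ae_conj_adjoint_commute hC.isSelfAdjoint hCP hY)
  have hTX : ∀ y, T (X y) = X (W (P (W.symm y))) := by
    intro y
    have h1 : ContinuousLinearMap.adjoint Y (X y) = W.symm y := by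
      refine ext_inner_left ℂ fun k => ?_
      rw [ContinuousLinearMap.adjoint_inner_right]
      change ⟪X (W k), X y⟫_ℂ = _
      rw [X.inner_map_map, ← W.inner_map_map, W.apply_symm_apply]
    change X (W (P (ContinuousLinearMap.adjoint Y (X y)))) = _
    rw [h1]
  let pr : ℝ → N →L[ℂ] N := multiplicityProj ν b
  have hprm : ∀ v, StronglyMeasurable fun x => pr x v := stronglyMeasurable_multiplicityProj ν b hρ
  -- The argument `|x|` makes `n` even. The compression to the fibre makes it commute with the
  -- density at every point.
  let n : ℝ → N →L[ℂ] N := fun x => pr |x| ∘L n₀ |x| ∘L pr |x|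
  have hnm : ∀ v, StronglyMeasurable fun x => n x v := by
    intro v
    have h1 := StronglyMeasurable.clm_apply_of_forall hprm
      (StronglyMeasurable.clm_apply_of_forall hn₀m (hprm v))
    exact h1.comp_measurable measurable_norm
  have hnp : ∀ x, (n x).IsPositive := by
    intro x
    have h1 := (hn₀p |x|).conj_adjoint (pr |x|)
    rwa [(multiplicityProj_isPositive ν b |x|).isSelfAdjoint.adjoint_eq] at h1
  have hnp' : ∀ x, n x ∘L pr |x| = n x ∧ pr |x| ∘L n x = n x := by
    intro x
    constructor <;> ext1 v
    · change pr |x| (n₀ |x| (pr |x| (pr |x| v))) = pr |x| (n₀ |x| (pr |x| v))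
      rw [multiplicityProj_multiplicityProj]
    · exact multiplicityProj_multiplicityProj ν b |x| _
  have hnb : ∀ x, ‖n x‖ ≤ ‖T‖ := by
    intro x
    have h1 := norm_multiplicityProj_le ν b |x|
    calc ‖n x‖ ≤ ‖pr |x|‖ * (‖n₀ |x|‖ * ‖pr |x|‖) :=
          (ContinuousLinearMap.opNorm_comp_le _ _).trans
            (mul_le_mul_of_nonneg_left (ContinuousLinearMap.opNorm_comp_le _ _) (norm_nonneg _))
      _ ≤ 1 * (‖T‖ * 1) := by
          gcongr
          exact hn₀b _
      _ = ‖T‖ := by ring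
  have hroot : ∀ x v, IsDiagonalDensity.root b a x v =
      ((√(multiplicityWeight ν ρ x) : ℝ) : ℂ) • pr x v := root_eq_smul_multiplicityProj ν b hρ
  have hdens : ∀ x, F.density x = (multiplicityWeight ν ρ x : ℂ) • pr x :=
    density_eq_smul_multiplicityProj ν b hρ
  -- Since `X` is injective, the action on functions can be checked in `L²(ν; N)`, provided that the
  -- field commutes with the root.
  have hact : ∀ (R' : ℝ → N →L[ℂ] N) (c : ℝ) (S : F.L2 →L[ℂ] F.L2),
      (∀ v, StronglyMeasurable fun x => R' x v) → (∀ x, ‖R' x‖ ≤ c) →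
      (∀ᵐ x ∂ν, ∀ v, IsDiagonalDensity.root b a x (R' x v) =
        R' x (IsDiagonalDensity.root b a x v)) →
      (∀ y, X (S y) =ᵐ[ν] fun x => R' x (X y x)) → F.ActsAs S fun f x => R' x (f x) := by
    intro R' c S h1 h2 h3 h4 f hf
    have hS := ha.sqIntegrable_apply b h0 h1 h2 h3 hf
    refine ⟨hS, X.injective (Lp.ext ?_)⟩
    filter_upwards [h4 (F.toL2 f hf), hX f hf, hX _ hS, h3] with x e1 e2 e3 e4
    refine e1.trans (Eq.trans ?_ e3.symm)
    rw [e4]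
    exact congrArg (R' x) e2
  let Q : F.L2 →L[ℂ] F.L2 := (W : K →L[ℂ] F.L2) ∘L C ∘L (W.symm : F.L2 →L[ℂ] K)
  let M : F.L2 →L[ℂ] F.L2 := (W : K →L[ℂ] F.L2) ∘L P ∘L (W.symm : F.L2 →L[ℂ] K)
  have hYW : ∀ y, Y (W.symm y) = X y := fun y => congrArg X (W.apply_symm_apply y)
  have hQ : F.ActsAs Q fun f x => cutoff R x • f x := by
    refine hact (fun x => cutoff R x • ContinuousLinearMap.id ℂ N) ‖cutoff R‖ Q
      (fun v => (cutoff R).continuous.stronglyMeasurable.smul_const v) (fun x => ?_)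
      (Filter.Eventually.of_forall fun x v => 
        map_smul (IsDiagonalDensity.root b a x) (cutoff R x) v) (fun y => ?_)
    · refine (norm_smul_le (cutoff R x) (ContinuousLinearMap.id ℂ N)).trans ?_
      exact (mul_le_of_le_one_right (norm_nonneg _) ContinuousLinearMap.norm_id_le).trans
        ((cutoff R).norm_coe_le_norm x)
    · have h1 := hY (cutoff R) (W.symm y)
      rw [selfAdjointCalculus_cutoff hC hR, hYW] at h1
      exact h1
  have hQ' : F.ActsAs Q fun f x => (x : ℂ) • f x := by
    intro f hf
    obtain ⟨h1, h2⟩ := hQ f hf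
    have e : (fun x => cutoff R x • f x) =ᵐ[F.base] fun x => (x : ℂ) • f x := by
      filter_upwards [hνae] with x hx
      rw [cutoff_of_mem ⟨hx.1.le, hx.2⟩]
    exact ⟨h1.congr e, h2.trans (F.toL2_congr _ _ e)⟩
  have hM : F.ActsAs M fun f x => n x (f x) := by
    refine hact n ‖T‖ M hnm hnb ?_ fun y => ?_
    · filter_upwards [hνae] with x hx v
      have hx' := hnp' x
      rw [abs_of_pos hx.1] at hx'
      rw [hroot, hroot, map_smul]
      congr 1
      exact (congrArg (fun S : N →L[ℂ] N => S v) hx'.2).trans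
        (congrArg (fun S : N →L[ℂ] N => S v) hx'.1).symm
    · have h1 : X (M y) = T (X y) := (hTX y).symm
      filter_upwards [ae_multiplicityProj_eq b h0 hX (M y), ae_multiplicityProj_eq b h0 hX y,
        hn₀ (X y), hνae] with x e1 e2 e3 hx
      change _ = pr |x| (n₀ |x| (pr |x| (X y x)))
      rw [abs_of_pos hx.1]
      change _ = multiplicityProj ν b x (n₀ x (multiplicityProj ν b x (X y x)))
      rw [e2, ← e3, ← h1, e1]
  refine ⟨N, inferInstance, inferInstance, inferInstance, hsep, F, n, ?_, ?_, ⟨_, b, ?_⟩, hnm, ?_,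
    hnp, ?_, Q, M, W, hQ', hM, ?_, ?_⟩
  · refine measure_mono_null (fun x hx => ?_) hν
    exact fun hx' => absurd hx'.1 (not_lt.2 hx)
  · intro t ht
    refine ha.dist_eq_one b h0 (hR0.trans ht) fun i => ?_
    refine setIntegral_multiplicityDensity ν hρ i _ (measure_mono_null ?_ hν)
    exact Set.compl_subset_compl.2 (Set.Ioc_subset_Ioc_right ht)
  · exact fun i j hij t => ha.inner_dist_of_ne b h0 hij t
  · intro x
    simp only [n, abs_neg]
  · intro x
    rw [hdens, smul_mul_assoc, mul_smul_comm]
    congr 1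
    exact (hnp' x).2.trans (hnp' x).1.symm
  · intro h
    change _ = W (C (W.symm (W h)))
    rw [W.symm_apply_apply]
  · intro h
    change _ = W (P (W.symm (W h)))
    rw [W.symm_apply_apply]

end Model

/-! ### Splitting an anticommuting pair along the sign of `B`. -/

section AntiCommuting

variable {H : Type*} [NormedAddCommGroup H] [InnerProductSpace ℂ H] [CompleteSpace H]

/-- Self-adjoint anticommuting operators `B`, `D` with `DB` injective split as
`B = C ⊕ (-C)`, `D = [[0, P], [P, 0]]` on the sum of two copies of a Hilbert space. -/
theorem exists_anticommuting_splitting {B D : H →L[ℂ] H} (hB : IsSelfAdjoint B)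
    (hD : IsSelfAdjoint D) (hanti : D * B + B * D = 0) (hker : ∀ h : H, D (B h) = 0 → h = 0) :
    ∃ (K : Submodule ℂ H) (_ : IsClosed (K : Set H)) (J : H →L[ℂ] H) (C P : K →L[ℂ] K),
      C.IsPositive ∧ (∀ k, C k = 0 → k = 0) ∧ P.IsPositive ∧ Commute C P ∧ ‖C‖ ≤ ‖B‖ ∧
      (∀ k : K, B k = C k ∧ B (J k) = -J (C k) ∧ D k = J (P k) ∧ D (J k) = P k) ∧
      (∀ k l : K, ⟪(k : H), J l⟫_ℂ = 0) ∧ (∀ h, ‖J h‖ = ‖h‖) ∧ ∀ h, ∃ k l : K, h = k + J l := by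
  have hDB : D * B = -(B * D) := eq_neg_of_add_eq_zero_left hanti
  have hBD : B * D = -(D * B) := by rw [hDB, neg_neg]
  have hB0 : ∀ h, B h = 0 → h = 0 := fun h hh => hker h (by rw [hh, map_zero])
  have hD0 : ∀ h, D h = 0 → h = 0 := fun h hh => hker h (by
    have : D (B h) = -(B (D h)) := congrArg (fun T : H →L[ℂ] H => T h) hDB
    rw [this, hh, map_zero, neg_zero])
  obtain ⟨S, A, hS, hS2, hA, hSA, -, hSc, hSa⟩ := exists_sign hB hB0
  obtain ⟨J, E, hJ, hJ2, hE, hJE, hEJ, -, hJa⟩ := exists_sign hD hD0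
  have hDS : D * S = -(S * D) := (hSa D hDB).1
  obtain ⟨hBJ, hBE⟩ := hJa B hBD
  obtain ⟨hSJ, hSE⟩ := hJa S (by rw [hDS, neg_neg])
  have hBS : B * S = S * B := (hSc B rfl).1
  have hS2' : ∀ h, S (S h) = h := fun h => congrArg (fun T : H →L[ℂ] H => T h) hS2
  have hJ2' : ∀ h, J (J h) = h := fun h => congrArg (fun T : H →L[ℂ] H => T h) hJ2
  have hSJ' : ∀ h, S (J h) = -J (S h) := fun h => congrArg (fun T : H →L[ℂ] H => T h) hSJ
  have hsymS : ∀ x y, ⟪S x, y⟫_ℂ = ⟪x, S y⟫_ℂ := ContinuousLinearMap.isSelfAdjoint_iff_isSymmetric.1 hS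
  have hsymJ : ∀ x y, ⟪J x, y⟫_ℂ = ⟪x, J y⟫_ℂ := ContinuousLinearMap.isSelfAdjoint_iff_isSymmetric.1 hJ
  -- The eigenspace `S = 1`; as `J` anticommutes with `S`, it carries `K` into the eigenspace `S =
  -- -1`.
  let K : Submodule ℂ H := LinearMap.eqLocus (S : H →ₗ[ℂ] H) LinearMap.id
  have hK : ∀ {h}, h ∈ K ↔ S h = h := Iff.rfl
  have hKS : ∀ k : K, S k = k := fun k => k.2
  have hBK : ∀ k : K, B k ∈ K := fun k => hK.2 (by
    have : B (S k) = S (B k) := congrArg (fun T : H →L[ℂ] H => T k) hBS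
    rw [← this, hKS])
  have hEK : ∀ k : K, E k ∈ K := fun k => hK.2 (by
    have : S (E k) = E (S k) := congrArg (fun T : H →L[ℂ] H => T k) hSE
    rw [this, hKS])
  let C : K →L[ℂ] K := (B ∘L K.subtypeL).codRestrict K hBK
  let P : K →L[ℂ] K := (E ∘L K.subtypeL).codRestrict K hEK
  have hpos : ∀ (T : H →L[ℂ] H) (T' : K →L[ℂ] K), T.IsPositive →
      (∀ k : K, ⟪T' k, k⟫_ℂ = ⟪T k, (k : H)⟫_ℂ) → T'.IsPositive := by
    intro T T' hT h
    rw [ContinuousLinearMap.isPositive_iff_complex]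
    intro k
    rw [h]
    exact (ContinuousLinearMap.isPositive_iff_complex T).1 hT k
  refine ⟨K, isClosed_eq S.continuous continuous_id, J, C, P, hpos A C hA fun k => ?_,
    fun k hk => ?_, hpos E P hE fun k => rfl, ?_, ?_, fun k => ⟨rfl, ?_, ?_, ?_⟩, fun k l => ?_,
    fun h => ?_, fun h => ?_⟩
  -- `B = SA` and `S` is the identity on `K`, so the quadratic forms of `B` and `A = |B|` agree
  -- there.
  · change ⟪B k, (k : H)⟫_ℂ = _
    have : B k = S (A k) := congrArg (fun T : H →L[ℂ] H => T k) hSA.symm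
    rw [this, hsymS, hKS]
  · exact Subtype.ext (hB0 _ (congrArg Subtype.val hk))
  · refine ContinuousLinearMap.ext fun k => Subtype.ext ?_
    exact congrArg (fun T : H →L[ℂ] H => T k) hBE
  · exact ContinuousLinearMap.opNorm_le_bound _ (norm_nonneg _) fun k => B.le_opNorm k
  · exact congrArg (fun T : H →L[ℂ] H => T k) hBJ
  · exact congrArg (fun T : H →L[ℂ] H => T k) hJE.symm
  · have : D (J k) = E (J (J k)) := congrArg (fun T : H →L[ℂ] H => T (J k)) hEJ.symm
    rw [this, hJ2']
    rfl
  · have h1 : ⟪(k : H), J l⟫_ℂ = -⟪(k : H), J l⟫_ℂ := by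
      conv_lhs => rw [← hKS k, hsymS, hSJ', hKS, inner_neg_right]
    exact self_eq_neg.1 h1
  · have h1 : ⟪J h, J h⟫_ℂ = ⟪h, h⟫_ℂ := by rw [hsymJ, hJ2']
    rw [inner_self_eq_norm_sq_to_K, inner_self_eq_norm_sq_to_K] at h1
    have h2 : ‖J h‖ ^ 2 = ‖h‖ ^ 2 := by exact_mod_cast h1
    exact (sq_eq_sq₀ (norm_nonneg _) (norm_nonneg _)).1 h2
  -- The spectral projections `(1 ± S) / 2`, the second one moved into `K` by `J`.
  · refine ⟨⟨(2 : ℂ)⁻¹ • (h + S h), hK.2 ?_⟩, ⟨(2 : ℂ)⁻¹ • J (h - S h), hK.2 ?_⟩, ?_⟩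
    · rw [map_smul, map_add, hS2', add_comm]
    · rw [map_smul, hSJ', map_sub, hS2', ← map_neg, neg_sub]
    · simp only [map_smul, hJ2']
      rw [← smul_add, add_add_sub_cancel, ← two_smul ℂ, smul_smul]
      norm_num

end AntiCommuting

end

/-! ### Assembly of the two realizations. -/

theorem theorem3p4 {H : Type*} [NormedAddCommGroup H] [InnerProductSpace ℂ H] [CompleteSpace H]
    [TopologicalSpace.SeparableSpace H]
    (B D : H →L[ℂ] H) (hB : IsSelfAdjoint B) (hD : IsSelfAdjoint D)
    (hanti : D * B + B * D = 0) (hker : ∀ h : H, D (B h) = 0 → h = 0) :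
    ∃ (N : Type) (_ : NormedAddCommGroup N) (_ : InnerProductSpace ℂ N) (_ : CompleteSpace N)
      (_ : TopologicalSpace.SeparableSpace N)
      (F Fs : OperatorMeasure N) (n : ℝ → N →L[ℂ] N),
      -- `F` lives on the positive half-line, inside `(0, ‖B‖]`, and has total mass `I`
      F.base (Set.Iic 0) = 0 ∧ (∀ t, ‖B‖ ≤ t → F.dist t = 1) ∧
      -- an orthonormal basis of generating vectors, whose cyclic subspaces are orthogonal
      (∃ (ι : Type) (e : HilbertBasis ι ℂ N), ∀ i j, i ≠ j → ∀ t, ⟪e i, F.dist t (e j)⟫_ℂ = 0) ∧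
      -- `Fs` is the odd extension of `F`
      (∀ t, Fs.dist (-t) = -Fs.dist t) ∧ (∀ t, 0 ≤ t → Fs.dist t = F.dist t) ∧
      -- `n` is measurable, even, non-negative, and commutes with `dF` and `dFs`
      (∀ v, StronglyMeasurable fun x => n x v) ∧
      (∀ x, n (-x) = n x) ∧ (∀ x, (n x).IsPositive) ∧
      (∀ᵐ x ∂F.base, F.density x * n x = n x * F.density x) ∧
      (∀ᵐ x ∂Fs.base, Fs.density x * n x = n x * Fs.density x) ∧
      ∃ (Q M : F.L2 →L[ℂ] F.L2) (Qs Ms : Fs.L2 →L[ℂ] Fs.L2)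
        (U : H ≃ₗᵢ[ℂ] WithLp 2 (F.L2 × F.L2)) (Us : H ≃ₗᵢ[ℂ] Fs.L2),
        F.ActsAs Q (fun f x => (x : ℂ) • f x) ∧
        F.ActsAs M (fun f x => n x (f x)) ∧
        Fs.ActsAs Qs (fun f x => (x : ℂ) • f x) ∧
        Fs.ActsAs Ms (fun f x => n x (f (-x))) ∧
        -- the realization by columns, `L²(N, dF) ⊗ ℂ² = L²(N, dF) ⊕ L²(N, dF)`
        (∀ h, U (B h) = WithLp.toLp 2 (Q (U h).fst, -Q (U h).snd)) ∧
        (∀ h, U (D h) = WithLp.toLp 2 (M (U h).snd, M (U h).fst)) ∧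
        -- the realization on the whole line
        (∀ h, Us (B h) = Qs (Us h)) ∧ (∀ h, Us (D h) = Ms (Us h)) ∧
        -- both realizations correspond under `f(x) = f₁(x)` for `x > 0`, `f₂(-x)` for `x < 0`
        ∀ (f₁ f₂ : ℝ → N) (h₁ : F.SqIntegrable f₁) (h₂ : F.SqIntegrable f₂),
          ∃ hs : Fs.SqIntegrable fun x => if 0 < x then f₁ x else f₂ (-x),
            Us.symm (Fs.toL2 (fun x => if 0 < x then f₁ x else f₂ (-x)) hs) =
              U.symm (WithLp.toLp 2 (F.toL2 f₁ h₁, F.toL2 f₂ h₂)) := by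
  obtain ⟨K, hK, J, C, P, hC, hC0, hP, hCP, hCB, hact, horth, hJ, hsplit⟩ :=
    exists_anticommuting_splitting hB hD hanti hker
  have : CompleteSpace K := hK.completeSpace_coe
  have : TopologicalSpace.SeparableSpace K := inferInstance
  obtain ⟨N, i1, i2, i3, i4, F, n, hF0, hFt, hFb, hnm, hne, hnp, hnF, Q, M, W, hQ, hM, hWC, hWP⟩ :=
    exists_model hC hC0 hP hCP hCB
  let V : WithLp 2 (F.L2 × F.L2) →ₗᵢ[ℂ] H :=
    { toFun := fun p => (W.symm p.fst : H) + J (W.symm p.snd)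
      map_add' := fun p q => by
        simp only [WithLp.add_fst, WithLp.add_snd, map_add, Submodule.coe_add]
        abel
      map_smul' := fun c p => by
        simp only [WithLp.smul_fst, WithLp.smul_snd, map_smul, Submodule.coe_smul, smul_add,
          RingHom.id_apply]
      norm_map' := fun p => by
        have h1 : ‖(W.symm p.fst : H) + J (W.symm p.snd)‖ ^ 2 = ‖p‖ ^ 2 := by
          rw [norm_add_sq (𝕜 := ℂ), horth, map_zero, mul_zero, add_zero, hJ, Submodule.norm_coe,
            Submodule.norm_coe, W.symm.norm_map, W.symm.norm_map, WithLp.prod_norm_sq_eq_of_L2]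
        exact (sq_eq_sq₀ (norm_nonneg _) (norm_nonneg _)).1 h1 }
  have hVsurj : Function.Surjective V := by
    intro h
    obtain ⟨k, l, rfl⟩ := hsplit h
    refine ⟨WithLp.toLp 2 (W k, W l), ?_⟩
    change (W.symm (W k) : H) + J (W.symm (W l)) = _
    rw [W.symm_apply_apply, W.symm_apply_apply]
  let U : H ≃ₗᵢ[ℂ] WithLp 2 (F.L2 × F.L2) := (LinearIsometryEquiv.ofSurjective V hVsurj).symm
  have hWC' : ∀ y, C (W.symm y) = W.symm (Q y) := fun y => W.injective (by
    rw [hWC, W.apply_symm_apply, W.apply_symm_apply])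
  have hWP' : ∀ y, P (W.symm y) = W.symm (M y) := fun y => W.injective (by
    rw [hWP, W.apply_symm_apply, W.apply_symm_apply])
  have hUB : ∀ h, U (B h) = WithLp.toLp 2 (Q (U h).fst, -Q (U h).snd) := by
    intro h
    obtain ⟨p, rfl⟩ := U.symm.surjective h
    refine U.symm.injective ?_
    rw [U.symm_apply_apply, U.apply_symm_apply]
    change B ((W.symm p.fst : H) + J (W.symm p.snd)) =
      (W.symm (Q p.fst) : H) + J (W.symm (-Q p.snd))
    rw [map_add, (hact _).1, (hact _).2.1, hWC', hWC', map_neg, Submodule.coe_neg, map_neg]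
  have hUD : ∀ h, U (D h) = WithLp.toLp 2 (M (U h).snd, M (U h).fst) := by
    intro h
    obtain ⟨p, rfl⟩ := U.symm.surjective h
    refine U.symm.injective ?_
    rw [U.symm_apply_apply, U.apply_symm_apply]
    change D ((W.symm p.fst : H) + J (W.symm p.snd)) =
      (W.symm (M p.snd) : H) + J (W.symm (M p.fst))
    rw [map_add, (hact _).2.2.1, (hact _).2.2.2, hWP', hWP', add_comm]
  let Fs := F.reflect hF0
  obtain ⟨Θ, hΘ⟩ := F.exists_reflect_equiv hF0
  let Us : H ≃ₗᵢ[ℂ] Fs.L2 := U.trans Θ.symm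
  -- Defining `Qs` and `Ms` by conjugation makes the intertwining automatic and leaves the formulas
  -- on functions to be checked through `Θ`.
  let Qs : Fs.L2 →L[ℂ] Fs.L2 := (Us : H →L[ℂ] Fs.L2) ∘L B ∘L (Us.symm : Fs.L2 →L[ℂ] H)
  let Ms : Fs.L2 →L[ℂ] Fs.L2 := (Us : H →L[ℂ] Fs.L2) ∘L D ∘L (Us.symm : Fs.L2 →L[ℂ] H)
  have hQs : ∀ y, Θ (Qs y) = WithLp.toLp 2 (Q (Θ y).fst, -Q (Θ y).snd) := by
    intro y
    change Θ (Θ.symm (U (B (U.symm (Θ y))))) = _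
    rw [Θ.apply_symm_apply, hUB, U.apply_symm_apply]
  have hMs : ∀ y, Θ (Ms y) = WithLp.toLp 2 (M (Θ y).snd, M (Θ y).fst) := by
    intro y
    change Θ (Θ.symm (U (D (U.symm (Θ y))))) = _
    rw [Θ.apply_symm_apply, hUD, U.apply_symm_apply]
  have hcommF : ∀ᵐ x ∂F.base, F.density x * n x = n x * F.density x := by
    filter_upwards [F.ae_pos hF0] with x hx
    have := hnF x
    rwa [abs_of_pos hx] at this
  refine ⟨N, i1, i2, i3, i4, F, Fs, n, hF0, hFt, hFb, ?_, ?_, hnm, hne, hnp, hcommF,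
    Filter.Eventually.of_forall hnF, Q, M, Qs, Ms, U, Us, hQ, hM, ?_, ?_, hUB, hUD, ?_, ?_, ?_⟩
  -- Needed for oddness at `t = 0`, where both sides use the same branch.
  · have h0 : F.dist 0 = 0 := ContinuousLinearMap.ext fun w => ext_inner_left ℂ fun v => by
      rw [F.dist_of_nonneg 0 le_rfl, Set.Ioc_self, Measure.restrict_empty, integral_zero_measure,
        zero_apply, inner_zero_right]
    intro t
    change (if 0 ≤ -t then F.dist (-t) else -F.dist (- -t)) =
      -(if 0 ≤ t then F.dist t else -F.dist (-t))
    rcases lt_trichotomy t 0 with ht | rfl | ht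
    · rw [if_pos (by linarith), if_neg ht.not_ge, neg_neg]
    · simp [h0]
    · rw [if_neg (by linarith), if_pos ht.le, neg_neg]
  · intro t ht
    exact if_pos ht
  · intro f hf
    obtain ⟨g1, g2⟩ := (F.reflect_sqIntegrable_iff hF0).1 hf
    obtain ⟨q1, e1⟩ := hQ f g1
    obtain ⟨q2, e2⟩ := hQ _ g2
    -- Reflecting `x f(x)` gives `-x f(-x)`; this is the source of the minus sign in the second
    -- column entry.
    have e : ((-1 : ℂ) • fun x : ℝ => (x : ℂ) • f (-x)) = fun x => ((-x : ℝ) : ℂ) • f (-x) := by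
      funext x
      simp
    have q2' : F.SqIntegrable fun x => ((-x : ℝ) : ℂ) • f (-x) := e ▸ q2.smul (-1)
    have hs : Fs.SqIntegrable fun x => (x : ℂ) • f x :=
      (F.reflect_sqIntegrable_iff hF0).2 ⟨q1, q2'⟩
    refine ⟨hs, Θ.injective ?_⟩
    rw [hQs, hΘ f hf, hΘ _ hs]
    have e3 : F.toL2 _ q2' = -F.toL2 _ q2 := by
      rw [← neg_one_smul ℂ (F.toL2 _ q2), ← F.toL2_smul]
      congr 1
      exact e.symm
    exact congrArg (WithLp.toLp 2) (Prod.ext e1 ((congrArg Neg.neg e2).trans e3.symm))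
  · intro f hf
    obtain ⟨g1, g2⟩ := (F.reflect_sqIntegrable_iff hF0).1 hf
    obtain ⟨q1, e1⟩ := hM f g1
    obtain ⟨q2, e2⟩ := hM _ g2
    -- Reflection swaps the two halves of `f`, and evenness of `n` leaves the operator factor
    -- unchanged.
    have q1' : F.SqIntegrable fun x => n (-x) (f (- -x)) := by
      simp only [neg_neg, hne]
      exact q1
    have hs : Fs.SqIntegrable fun x => n x (f (-x)) :=
      (F.reflect_sqIntegrable_iff hF0).2 ⟨q2, q1'⟩
    refine ⟨hs, Θ.injective ?_⟩
    rw [hMs, hΘ f hf, hΘ _ hs]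
    refine congrArg (WithLp.toLp 2) (Prod.ext e2 (e1.trans ?_))
    exact F.toL2_congr _ _ (Filter.Eventually.of_forall fun x => by simp only [neg_neg, hne])
  · intro h
    change _ = Us (B (Us.symm (Us h)))
    rw [Us.symm_apply_apply]
  · intro h
    change _ = Us (D (Us.symm (Us h)))
    rw [Us.symm_apply_apply]
  · intro f₁ f₂ h₁ h₂
    have e1 : f₁ =ᵐ[F.base] fun x => if 0 < x then f₁ x else f₂ (-x) := by
      filter_upwards [F.ae_pos hF0] with x hx
      simp [hx]
    have e2 : f₂ =ᵐ[F.base] fun x => if 0 < -x then f₁ (-x) else f₂ (- -x) := by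
      filter_upwards [F.ae_pos hF0] with x hx
      simp [hx.le]
    refine ⟨(F.reflect_sqIntegrable_iff hF0).2 ⟨h₁.congr e1, h₂.congr e2⟩, ?_⟩
    change U.symm (Θ _) = _
    rw [hΘ, F.toL2_congr h₁ (h₁.congr e1) e1, F.toL2_congr h₂ (h₂.congr e2) e2]
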